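/- Let $n\ge 1$, let $(d)=(d_1,\dots,d_n)$ be positive integers, $D=\max_i d_i$, and let $\mathcal H_{(d)}$ be the space of systems $f=(f_1,\dots,f_n)$ of complex homogeneous polynomials in $X_0,\dots,X_n$ with $\deg f_i=d_i$, equipped with the unitarily invariant (Bombieri–Weyl) Hermitian product $\langle f,g\rangle=\sum_i\sum_{|\alpha|=d_i}\binom{d_i}{\alpha}^{-1}\overline{f_{i,\alpha}}\,g_{i,\alpha}$. Let $$V=\{(f,x)\in\mathbb P(\mathcal H_{(d)})\times\mathbb P(\mathbb C^{n+1}) : f(x)=0\},$$ and for $(f,x)$ put $$\mu_{\rm norm}(f,x)=\|f\|\,\bigl\|\bigl(Df(x)|_{N_x}\bigr)^{-1}\,\mathrm{diag}\bigl(d_i^{1/2}\|x\|^{d_i-1}\bigr)\bigr\|,$$ where $N_x$ is the Hermitian complement of $x$ and the second norm is the operator norm, with $\mu_{\rm norm}(f,x)=\infty$ if $Df(x)|_{N_x}$ is not invertible. Tangent vectors of the projective spaces are measured in the Fubini–Study metrics (whose Riemannian distance is the angle). For every $\epsilon>0$ there is a $C>0$, depending only on $\epsilon$ (not on $n$, $(d)$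 or the path), with the following property. Let $(f_t,\zeta_t)$, $t_0\le t\le t_1$, be a $C^1$ path in $V$ that is not a constant path at a pair with $\mu_{\rm norm}=\infty$. Define $S_0=t_0$ and let $S_i$ be the first $t\in[S_{i-1},t_1]$ such that $$\int_{S_{i-1}}^{t}\bigl(\|\dot f_s\|+\|\dot\zeta_s\|\bigr)\,ds=\frac{C}{D^{3/2}\mu_{\rm norm}(f_{S_{i-1}},\zeta_{S_{i-1}})}\quad\text{or}\quad t=t_1$$ (with $C/\infty=0$). These $S_i$ are well defined. Put $$X=\frac{1+\epsilon}{C}\,D^{3/2}\int_{t_0}^{t_1}\mu_{\rm norm}(f_t,\zeta_t)\bigl(\|\dot f_t\|+\|\dot\zeta_t\|\bigr)\,dt\in[0,\infty]$$ (with $\infty\cdot 0=0$). If $X<\infty$, then $S_k=t_1$ for some integer $$k\le\max\bigl(1,\lceil X\rceil\bigr).$$ Moreover, for every $k$ with $S_k=t_1$, $$\mu_{\rm norm}(f_{t_1},\zeta_{t_1})\le(1+\epsilon)^k\,\mu_{\rm norm}(f_{t_0},\zeta_{t_0}).$$ -/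

import Mathlib

open scoped ENNReal InnerProductSpace

/-- The space `ℋ_(d)` of systems `f = (f₁, …, fₙ)` of complex homogeneous polynomials in the
`n + 1` variables `X₀, …, Xₙ`, where `fᵢ` has degree `dᵢ`. -/
def PolySystem (n : ℕ) (d : Fin n → ℕ) : Type :=
  ∀ i : Fin n, MvPolynomial.homogeneousSubmodule (Fin (n + 1)) ℂ (d i)

namespace PolySystem

noncomputable section

variable {n : ℕ} {d : Fin n → ℕ}

instance : AddCommGroup (PolySystem n d) := inferInstanceAs (AddCommGroup (∀ _ : Fin n, _))

instance : Module ℂ (PolySystem n d) := inferInstanceAs (Module ℂ (∀ _ : Fin n, _))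

/-- The `i`-th polynomial of a system. -/
def poly (f : PolySystem n d) (i : Fin n) : MvPolynomial (Fin (n + 1)) ℂ := (f i).1

/-- The exponents `α` of the monomials of degree `l` in `X₀, …, Xₙ`. -/
def exponents (n l : ℕ) : Finset (Fin (n + 1) →₀ ℕ) :=
  Finset.finsuppAntidiag Finset.univ l

/-- The unitarily invariant (Bombieri-Weyl, Kostlan) Hermitian product: the sum over `i` of
`∑_α (multinomial α)⁻¹ * conj (f_{i,α}) * g_{i,α}`, linear in the second argument. -/
def weylInner (f g : PolySystem n d) : ℂ :=
  ∑ i : Fin n, ∑ α ∈ exponents n (d i),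
    ((Nat.multinomial Finset.univ α : ℝ)⁻¹ : ℝ) *
      (starRingEnd ℂ ((f.poly i).coeff α) * (g.poly i).coeff α)

theorem weylInner_self (f : PolySystem n d) :
    weylInner f f = ((∑ i : Fin n, ∑ α ∈ exponents n (d i),
      (Nat.multinomial Finset.univ α : ℝ)⁻¹ * ‖(f.poly i).coeff α‖ ^ 2 : ℝ) : ℂ) := by
  simp only [weylInner, Complex.ofReal_sum, Complex.ofReal_mul, Complex.conj_mul',
    Complex.ofReal_pow]

/-- `weylInner` satisfies the axioms of a Hermitian inner product. -/
@[reducible] def weylCore (n : ℕ) (d : Fin n → ℕ) : InnerProductSpace.Core ℂ (PolySystem n d) where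
  inner := weylInner
  conj_inner_symm f g := by
    simp only [weylInner, map_sum, map_mul, Complex.conj_conj, Complex.conj_ofReal]
    refine Finset.sum_congr rfl fun i _ => Finset.sum_congr rfl fun α _ => ?_
    ring
  re_inner_nonneg f := by
    rw [weylInner_self, RCLike.re_eq_complex_re, Complex.ofReal_re]
    exact Finset.sum_nonneg fun i _ => Finset.sum_nonneg fun α _ => by positivity
  add_left f g h := by
    have key : ∀ i, (f + g).poly i = f.poly i + g.poly i := fun i => rfl
    simp only [weylInner, key, MvPolynomial.coeff_add, map_add, ← Finset.sum_add_distrib]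
    refine Finset.sum_congr rfl fun i _ => Finset.sum_congr rfl fun α _ => ?_
    ring
  smul_left f g r := by
    have key : ∀ i, (r • f).poly i = r • f.poly i := fun i => rfl
    simp only [weylInner, key, MvPolynomial.coeff_smul, smul_eq_mul, map_mul, Finset.mul_sum]
    refine Finset.sum_congr rfl fun i _ => Finset.sum_congr rfl fun α _ => ?_
    ring
  definite f h := by
    rw [weylInner_self] at h
    have h0 := Complex.ofReal_eq_zero.1 h
    have hnn : ∀ i : Fin n, ∀ α ∈ exponents n (d i),
        0 ≤ (Nat.multinomial Finset.univ α : ℝ)⁻¹ * ‖(f.poly i).coeff α‖ ^ 2 :=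
      fun i α _ => by positivity
    have h1 := (Finset.sum_eq_zero_iff_of_nonneg
      (fun i _ => Finset.sum_nonneg (hnn i))).1 h0
    funext i
    apply Subtype.ext
    ext α
    have h2 := (Finset.sum_eq_zero_iff_of_nonneg (hnn i)).1 (h1 i (Finset.mem_univ i))
    change (f.poly i).coeff α = 0
    by_cases hα : α ∈ exponents n (d i)
    · have h3 := h2 α hα
      have hm : (Nat.multinomial Finset.univ α : ℝ)⁻¹ ≠ 0 := by
        have := Nat.multinomial_pos Finset.univ α
        positivity
      simpa [hm] using h3
    · have hf : (f.poly i).IsHomogeneous (d i) := (f i).2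
      by_contra hne
      apply hα
      have hdeg := hf hne
      simp only [exponents, Finset.mem_finsuppAntidiag, Finset.subset_univ, and_true]
      rw [← hdeg, Finsupp.weight_apply, Finsupp.sum_fintype _ _ (by simp)]
      simp

instance : NormedAddCommGroup (PolySystem n d) :=
  @InnerProductSpace.Core.toNormedAddCommGroup ℂ _ _ _ _ (weylCore n d)

instance : InnerProductSpace ℂ (PolySystem n d) :=
  InnerProductSpace.ofCore (weylCore n d).toCore

/-- `f(x) ∈ ℂⁿ`. -/
def eval (f : PolySystem n d) (x : EuclideanSpace ℂ (Fin (n + 1))) : EuclideanSpace ℂ (Fin n) :=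
  WithLp.toLp 2 fun i => MvPolynomial.eval (fun j => x j) (f.poly i)

/-- The derivative `Df(x) : ℂⁿ⁺¹ → ℂⁿ`, given by the Jacobian matrix `(∂fᵢ/∂Xⱼ)(x)`. -/
def jacobian (f : PolySystem n d) (x : EuclideanSpace ℂ (Fin (n + 1))) :
    EuclideanSpace ℂ (Fin (n + 1)) →L[ℂ] EuclideanSpace ℂ (Fin n) :=
  LinearMap.toContinuousLinearMap
    (Matrix.toEuclideanLin (Matrix.of fun (i : Fin n) (j : Fin (n + 1)) =>
      MvPolynomial.eval (fun k => x k) (MvPolynomial.pderiv j (f.poly i))))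

/-- `Df(x)|_{N_x}`, the restriction of `Df(x)` to the Hermitian complement `N_x` of `x`. -/
def jacobianPerp (f : PolySystem n d) (x : EuclideanSpace ℂ (Fin (n + 1))) :
    ((ℂ ∙ x)ᗮ : Submodule ℂ (EuclideanSpace ℂ (Fin (n + 1)))) →L[ℂ] EuclideanSpace ℂ (Fin n) :=
  (f.jacobian x).comp ((ℂ ∙ x)ᗮ).subtypeL

open Classical in
/-- The normalized condition number
`μ_norm(f, x) = ‖f‖ ‖(Df(x)|_{N_x})⁻¹ Δ(dᵢ^{1/2} ‖x‖^{dᵢ - 1})‖` (operator norm), with value `∞`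
if `Df(x)|_{N_x}` is not invertible. -/
def muNorm (f : PolySystem n d) (x : EuclideanSpace ℂ (Fin (n + 1))) : ℝ≥0∞ :=
  if (f.jacobianPerp x).IsInvertible then
    ENNReal.ofReal (‖f‖ * ‖(f.jacobianPerp x).inverse.comp
      (Matrix.toEuclideanCLM (𝕜 := ℂ) (Matrix.diagonal fun i : Fin n =>
        ((√(d i : ℝ) * ‖x‖ ^ (d i - 1) : ℝ) : ℂ)))‖)
  else ∞

end

end PolySystem

noncomputable section

/-- The maximum `D` of the degrees. -/
def maxDegree {n : ℕ} (d : Fin n → ℕ) : ℕ := Finset.univ.sup d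

/-- The Fubini-Study length, in the projective space of `E`, of the tangent vector at the class of
`x ≠ 0` that is represented by `v`: the norm of the component of `v` orthogonal to `ℂ x`, divided
by `‖x‖`. (The induced Riemannian distance is the angle between complex lines.) -/
def projNorm {E : Type*} [NormedAddCommGroup E] [InnerProductSpace ℂ E] (x v : E) : ℝ :=
  ‖((ℂ ∙ x)ᗮ).starProjection v‖ / ‖x‖

/-- `(f_t, ζ_t)`, `t₀ ≤ t ≤ t₁`, represents a `C¹` path in the solution variety
`V ⊆ ℙ(ℋ_(d)) × ℙ(ℂⁿ⁺¹)`. A `C¹` path in `V` is the same as such a pair of `C¹` curves of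
representatives, up to nonvanishing `C¹` scalar factors in each component. -/
structure IsC1SolutionPath {n : ℕ} {d : Fin n → ℕ} (t₀ t₁ : ℝ)
    (f : ℝ → PolySystem n d) (ζ : ℝ → EuclideanSpace ℂ (Fin (n + 1))) : Prop where
  contDiffOn_system : ContDiffOn ℝ 1 f (Set.Icc t₀ t₁)
  contDiffOn_zero : ContDiffOn ℝ 1 ζ (Set.Icc t₀ t₁)
  system_ne_zero : ∀ t ∈ Set.Icc t₀ t₁, f t ≠ 0
  zero_ne_zero : ∀ t ∈ Set.Icc t₀ t₁, ζ t ≠ 0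
  eval_eq_zero : ∀ t ∈ Set.Icc t₀ t₁, (f t).eval (ζ t) = 0

/-- `‖ḟ_t‖ + ‖ζ̇_t‖`, the tangent vectors being measured in the two projective spaces (one-sided
derivatives at the ends of `[t₀, t₁]`). -/
def pathSpeed {n : ℕ} {d : Fin n → ℕ} (t₀ t₁ : ℝ)
    (f : ℝ → PolySystem n d) (ζ : ℝ → EuclideanSpace ℂ (Fin (n + 1))) (t : ℝ) : ℝ :=
  projNorm (f t) (derivWithin f (Set.Icc t₀ t₁) t) +
    projNorm (ζ t) (derivWithin ζ (Set.Icc t₀ t₁) t)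

/-- `∫_a^b (‖ḟ_t‖ + ‖ζ̇_t‖) dt` -/
def pathLength {n : ℕ} {d : Fin n → ℕ} (t₀ t₁ : ℝ)
    (f : ℝ → PolySystem n d) (ζ : ℝ → EuclideanSpace ℂ (Fin (n + 1))) (a b : ℝ) : ℝ≥0∞ :=
  ∫⁻ t in Set.Icc a b, ENNReal.ofReal (pathSpeed t₀ t₁ f ζ t)

/-- `∫_{t₀}^{t₁} μ_norm(f_t, ζ_t) (‖ḟ_t‖ + ‖ζ̇_t‖) dt`, with values in `[0, ∞]`. -/
def conditionLength {n : ℕ} {d : Fin n → ℕ} (t₀ t₁ : ℝ)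
    (f : ℝ → PolySystem n d) (ζ : ℝ → EuclideanSpace ℂ (Fin (n + 1))) : ℝ≥0∞ :=
  ∫⁻ t in Set.Icc t₀ t₁, (f t).muNorm (ζ t) * ENNReal.ofReal (pathSpeed t₀ t₁ f ζ t)

/-- `S` is the greedy subdivision of the path with constant `C`: `S₀ = t₀`, and `Sᵢ₊₁` is the first
`t` in `[Sᵢ, t₁]` such that the piece over `[Sᵢ, t]` has length
`C / (D^{3/2} μ_norm(f_{Sᵢ}, ζ_{Sᵢ}))`, or such that `t = t₁`. -/
structure IsGreedySubdivision {n : ℕ} {d : Fin n → ℕ} (C t₀ t₁ : ℝ)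
    (f : ℝ → PolySystem n d) (ζ : ℝ → EuclideanSpace ℂ (Fin (n + 1))) (S : ℕ → ℝ) : Prop where
  start : S 0 = t₀
  step : ∀ i : ℕ, IsLeast {t : ℝ | t ∈ Set.Icc (S i) t₁ ∧
    (pathLength t₀ t₁ f ζ (S i) t =
        ENNReal.ofReal C /
          (ENNReal.ofReal ((maxDegree d : ℝ) ^ (3 / 2 : ℝ)) * (f (S i)).muNorm (ζ (S i))) ∨
      t = t₁)} (S (i + 1))

end

/-! The reciprocal of `muNorm` is Lipschitz along the path, with a constant of order $D^{3/2}$ in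
arc length. A greedy piece has length at most $C/(D^{3/2}\mu)$ with $\mu$ taken at its start, so on
it $\mu$ changes only by a factor close to 1. The bound on the final condition number follows by
multiplying over the pieces. For the count, a piece that does not reach $t_1$ has length exactly
$C/(D^{3/2}\mu)$, and so contributes nearly $C/D^{3/2}$ to the condition length.

For the Lipschitz bound, `muNorm_le_iff` turns the norm of an inverse into a lower bound for the
normalized derivative on $x^\perp$. Such a lower bound is stable under perturbation. Cauchy-Schwarz
for the Weyl product gives $|f_i(z)|\le\|f_i\|\|z\|^{d_i}$, and Cauchy's integral estimate then
bounds first and second derivatives by $8d_i$ and $8d_i^2$ times $\|f_i\|$. After division by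
$\sqrt{d_i}$ this is $8D^{3/2}$, with no dependence on $n$ (`muNorm_le_of_norm_sub_le`). Horizontal
unit lifts (`exists_unit_lift`) convert Fubini-Study length into a bound on norm distances of
representatives.

The rest concerns a real parameter only: a continuous speed `V` and a function `μ` satisfying
`IsStable`. The delicate point is that finite condition length forces $\mu(t_0)<\infty$
(`ne_top_of_setLIntegral_ne_top`): stability makes $\mu$ at least inversely proportional to the
distance from a point where it is infinite, which is not integrable. -/

namespace MvPolynomial

/-! ### Cauchy estimates for directional derivatives of polynomials -/

variable {ι : Type*} [Fintype ι]

/-- The derivative of a polynomial in a constant direction. -/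
noncomputable def dirDeriv (p : MvPolynomial ι ℂ) (v : EuclideanSpace ℂ ι) : MvPolynomial ι ℂ :=
  ∑ j, C (v j) * pderiv j p

theorem eval_dirDeriv (p : MvPolynomial ι ℂ) (x v : EuclideanSpace ℂ ι) :
    eval (fun j => x j) (p.dirDeriv v) = ∑ j, eval (fun k => x k) (pderiv j p) * v j := by
  simp [dirDeriv, map_sum, mul_comm]

theorem hasDerivAt_eval_line (p : MvPolynomial ι ℂ) (z v : EuclideanSpace ℂ ι) (s : ℂ) :
    HasDerivAt (fun s : ℂ => eval (fun j => (z + s • v) j) p)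
      (eval (fun j => (z + s • v) j) (p.dirDeriv v)) s := by
  classical
  rw [eval_dirDeriv]
  induction p using MvPolynomial.induction_on with
  | C a => simpa using hasDerivAt_const s a
  | add p q hp hq =>
    simp only [map_add, add_mul, Finset.sum_add_distrib]
    exact hp.add hq
  | mul_X p k hp =>
    have h1 : HasDerivAt (fun s : ℂ => (z + s • v) k) (v k) s := by
      simpa using ((hasDerivAt_id s).mul_const (v k)).const_add (z k)
    have h2 := hp.mul h1
    simp only [map_mul, eval_X]
    refine HasDerivAt.congr_deriv h2 ?_
    symm
    simp only [Derivation.leibniz, pderiv_X, smul_eq_mul, map_add, map_mul, eval_X, add_mul,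
      Finset.sum_add_distrib, Finset.sum_mul]
    rw [add_comm]
    congr 1
    · exact Finset.sum_congr rfl fun j _ => by ring
    · rw [Finset.sum_eq_single k]
      · simp
      · intro j _ hj
        simp [hj.symm]
      · simp

/-- Cauchy's estimate for the one-variable polynomial obtained by restricting `p` to the complex
line through `z` in direction `v`. -/
theorem norm_eval_dirDeriv_le (p : MvPolynomial ι ℂ) (z v : EuclideanSpace ℂ ι) {R B : ℝ}
    (hR : 0 < R) (h : ∀ s : ℂ, ‖s‖ = R → ‖eval (fun j => (z + s • v) j) p‖ ≤ B) :
    ‖eval (fun j => z j) (p.dirDeriv v)‖ ≤ B / R := by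
  have hd : Differentiable ℂ (fun s : ℂ => eval (fun j => (z + s • v) j) p) :=
    fun s => (hasDerivAt_eval_line p z v s).differentiableAt
  have h1 := Complex.norm_deriv_le_of_forall_mem_sphere_norm_le (c := 0) hR hd.diffContOnCl
    (C := B) (fun s hs => h s (by simpa using hs))
  rw [(hasDerivAt_eval_line p z v 0).deriv] at h1
  simpa using h1

theorem dirDeriv_zero (p : MvPolynomial ι ℂ) : p.dirDeriv 0 = 0 := by
  simp [dirDeriv]

theorem one_add_div_pow_le_exp (a : ℝ) (ha : 0 ≤ a) {l : ℕ} (hl : 1 ≤ l) :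
    (1 + a / l) ^ l ≤ Real.exp a := by
  have hl' : (0 : ℝ) < l := by exact_mod_cast hl
  calc (1 + a / l) ^ l ≤ (Real.exp (a / l)) ^ l := by
        refine pow_le_pow_left₀ (by positivity) ?_ _
        rw [add_comm]; exact Real.add_one_le_exp _
    _ = Real.exp a := by rw [← Real.exp_nat_mul]; congr 1; field_simp

theorem one_add_two_div_pow_le {l : ℕ} (hl : 1 ≤ l) : (1 + 2 / (l : ℝ)) ^ l ≤ 8 := by
  refine (one_add_div_pow_le_exp 2 (by norm_num) hl).trans ?_
  have h : Real.exp 2 = Real.exp 1 * Real.exp 1 := by rw [← Real.exp_add]; norm_num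
  have := Real.exp_one_lt_d9
  have := Real.exp_pos 1
  rw [h]; nlinarith

variable {p : MvPolynomial ι ℂ} {l : ℕ} {N : ℝ}

/-- Derivatives near the unit ball. -/
theorem norm_eval_dirDeriv_le_of_norm_le (hl : 1 ≤ l) (hN : 0 ≤ N)
    (hp : ∀ z : EuclideanSpace ℂ ι, ‖eval (fun j => z j) p‖ ≤ N * ‖z‖ ^ l)
    {x : EuclideanSpace ℂ ι} (hx : ‖x‖ ≤ 1 + 1 / l) (v : EuclideanSpace ℂ ι) :
    ‖eval (fun j => x j) (p.dirDeriv v)‖ ≤ 8 * l * N * ‖v‖ := by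
  rcases eq_or_ne v 0 with rfl | hv0
  · simp [dirDeriv_zero]
  have hl' : (0 : ℝ) < l := by exact_mod_cast hl
  have hvn : 0 < ‖v‖ := norm_pos_iff.2 hv0
  -- This radius moves the point by $1/l$, hence within the ball of radius $1+2/l$, where $|p|\le
  -- N(1+2/l)^l\le Ne^2\le 8N$. Allowing `x` in the ball of radius $1+1/l$ leaves room for a second
  -- Cauchy estimate from the unit ball.
  have hR : 0 < 1 / (l * ‖v‖) := by positivity
  refine (norm_eval_dirDeriv_le p x v (B := N * 8) hR fun s hs => ?_).trans (le_of_eq ?_)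
  · refine (hp _).trans (mul_le_mul_of_nonneg_left ?_ hN)
    have h1 : ‖x + s • v‖ ≤ 1 + 2 / (l : ℝ) := by
      refine (norm_add_le _ _).trans ?_
      rw [norm_smul, hs]
      have : 1 / (l * ‖v‖) * ‖v‖ = 1 / (l : ℝ) := by field_simp
      rw [this]
      calc ‖x‖ + 1 / (l : ℝ) ≤ 1 + 1 / l + 1 / l := by gcongr
        _ = _ := by ring
    exact (pow_le_pow_left₀ (norm_nonneg _) h1 _).trans (one_add_two_div_pow_le hl)
  · field_simp

theorem norm_eval_dirDeriv_dirDeriv_le (hl : 1 ≤ l) (hN : 0 ≤ N)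
    (hp : ∀ z : EuclideanSpace ℂ ι, ‖eval (fun j => z j) p‖ ≤ N * ‖z‖ ^ l)
    {x : EuclideanSpace ℂ ι} (hx : ‖x‖ ≤ 1) (v w : EuclideanSpace ℂ ι) :
    ‖eval (fun j => x j) ((p.dirDeriv v).dirDeriv w)‖ ≤ 8 * l ^ 2 * N * ‖v‖ * ‖w‖ := by
  rcases eq_or_ne w 0 with rfl | hw0
  · simp [dirDeriv_zero]
  have hl' : (0 : ℝ) < l := by exact_mod_cast hl
  have hwn : 0 < ‖w‖ := norm_pos_iff.2 hw0
  have hR : 0 < 1 / (l * ‖w‖) := by positivity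
  refine (norm_eval_dirDeriv_le _ x w (B := 8 * l * N * ‖v‖) hR fun s hs => ?_).trans (le_of_eq ?_)
  · refine norm_eval_dirDeriv_le_of_norm_le hl hN hp ?_ v
    refine (norm_add_le _ _).trans ?_
    rw [norm_smul, hs]
    have : 1 / (l * ‖w‖) * ‖w‖ = 1 / (l : ℝ) := by field_simp
    rw [this]
    gcongr
  · field_simp

/-- The derivative is Lipschitz on the unit ball. -/
theorem norm_eval_dirDeriv_sub_le (hl : 1 ≤ l) (hN : 0 ≤ N)
    (hp : ∀ z : EuclideanSpace ℂ ι, ‖eval (fun j => z j) p‖ ≤ N * ‖z‖ ^ l)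
    {x y : EuclideanSpace ℂ ι} (hx : ‖x‖ ≤ 1) (hy : ‖y‖ ≤ 1) (v : EuclideanSpace ℂ ι) :
    ‖eval (fun j => y j) (p.dirDeriv v) - eval (fun j => x j) (p.dirDeriv v)‖ ≤
      8 * l ^ 2 * N * ‖v‖ * ‖y - x‖ := by
  have hd : ∀ s ∈ Set.Icc (0 : ℝ) 1, HasDerivWithinAt
      (fun s : ℝ => eval (fun j => (x + (s : ℂ) • (y - x)) j) (p.dirDeriv v))
      (eval (fun j => (x + (s : ℂ) • (y - x)) j) ((p.dirDeriv v).dirDeriv (y - x)))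
      (Set.Icc 0 1) s := fun s _ =>
    (hasDerivAt_eval_line (p.dirDeriv v) x (y - x) (s : ℂ)).comp_ofReal.hasDerivWithinAt
  have h := norm_image_sub_le_of_norm_deriv_le_segment_01' hd
    (C := 8 * l ^ 2 * N * ‖v‖ * ‖y - x‖) fun s hs => by
      refine norm_eval_dirDeriv_dirDeriv_le hl hN hp ?_ v (y - x)
      have h0 := hs.1
      have h1 := hs.2.le
      have : x + (s : ℂ) • (y - x) = ((1 - s : ℝ) : ℂ) • x + (s : ℂ) • y := by
        push_cast; module
      rw [this]
      refine (norm_add_le _ _).trans ?_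
      rw [norm_smul, norm_smul, Complex.norm_real, Complex.norm_real, Real.norm_of_nonneg h0,
        Real.norm_of_nonneg (by linarith)]
      nlinarith
  simpa using h

end MvPolynomial

/-! ### The Weyl norm bounds values -/

namespace PolySystem

variable {n : ℕ} {d : Fin n → ℕ}

/-- The Weyl norm of the `i`-th polynomial of a system. -/
noncomputable def polyNorm (f : PolySystem n d) (i : Fin n) : ℝ :=
  √(∑ α ∈ exponents n (d i), (Nat.multinomial Finset.univ α : ℝ)⁻¹ * ‖(f.poly i).coeff α‖ ^ 2)

theorem polyNorm_nonneg (f : PolySystem n d) (i : Fin n) : 0 ≤ f.polyNorm i := Real.sqrt_nonneg _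

theorem sum_polyNorm_sq (f : PolySystem n d) : ∑ i, f.polyNorm i ^ 2 = ‖f‖ ^ 2 := by
  rw [norm_sq_eq_re_inner (𝕜 := ℂ) f]
  change _ = RCLike.re (weylInner f f)
  rw [weylInner_self, RCLike.re_eq_complex_re, Complex.ofReal_re]
  refine Finset.sum_congr rfl fun i _ => Real.sq_sqrt ?_
  positivity

/-- The squares of the component norms add up to $\|f\|^2$, so componentwise estimates combine
without a factor depending on `n`. -/
theorem norm_le_of_forall_norm_le (f : PolySystem n d) {K : ℝ} (hK : 0 ≤ K)
    {u : EuclideanSpace ℂ (Fin n)} (h : ∀ i, ‖u i‖ ≤ K * f.polyNorm i) : ‖u‖ ≤ K * ‖f‖ := by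
  refine abs_le_of_sq_le_sq' ?_ (by positivity) |>.2
  rw [EuclideanSpace.norm_sq_eq, mul_pow, ← sum_polyNorm_sq, Finset.mul_sum]
  refine Finset.sum_le_sum fun i _ => ?_
  rw [← mul_pow]
  exact pow_le_pow_left₀ (norm_nonneg _) (h i) 2

theorem sum_exponents_multinomial (l : ℕ) (y : Fin (n + 1) → ℝ) :
    ∑ α ∈ exponents n l, (Nat.multinomial Finset.univ α : ℝ) * ∏ j, y j ^ α j = (∑ j, y j) ^ l := by
  rw [Finset.sum_pow_eq_sum_piAntidiag]
  refine Finset.sum_bij (fun α _ => ⇑α) ?_ ?_ ?_ ?_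
  · intro α hα
    simpa [exponents] using hα
  · intro a _ b _ h
    exact DFunLike.coe_injective h
  · intro b hb
    refine ⟨Finsupp.equivFunOnFinite.symm b, ?_, rfl⟩
    simpa [exponents] using hb
  · intro α _
    rfl

/-- Cauchy-Schwarz with the multinomial weights: by the multinomial theorem the weights inverse to
those of the Weyl norm satisfy $\sum_\alpha\binom{l}{\alpha}|z^\alpha|^2=\|z\|^{2l}$. -/
theorem norm_eval_poly_le (f : PolySystem n d) (i : Fin n) (z : EuclideanSpace ℂ (Fin (n + 1))) :
    ‖MvPolynomial.eval (fun j => z j) (f.poly i)‖ ≤ f.polyNorm i * ‖z‖ ^ d i := by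
  have hsupp : (f.poly i).support ⊆ exponents n (d i) := by
    intro α hα
    have hf : (f.poly i).IsHomogeneous (d i) := (f i).2
    have hdeg := hf (MvPolynomial.mem_support_iff.1 hα)
    simp only [exponents, Finset.mem_finsuppAntidiag, Finset.subset_univ, and_true]
    rw [← hdeg, Finsupp.weight_apply, Finsupp.sum_fintype _ _ (by simp)]
    simp
  have heval : MvPolynomial.eval (fun j => z j) (f.poly i) =
      ∑ α ∈ exponents n (d i), (f.poly i).coeff α * ∏ j, z j ^ α j := by
    rw [MvPolynomial.eval_eq']
    refine Finset.sum_subset hsupp fun α _ hα => ?_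
    rw [MvPolynomial.notMem_support_iff.1 hα, zero_mul]
  have hz : ‖z‖ ^ d i = √(∑ α ∈ exponents n (d i),
      (Nat.multinomial Finset.univ α : ℝ) * ∏ j, (‖z j‖ ^ 2) ^ α j) := by
    rw [sum_exponents_multinomial, ← EuclideanSpace.norm_sq_eq, ← pow_mul, mul_comm, pow_mul,
      Real.sqrt_sq (by positivity)]
  rw [heval, hz, polyNorm]
  refine (norm_sum_le _ _).trans (le_trans (le_of_eq ?_) (Real.sum_sqrt_mul_sqrt_le _ ?_ ?_))
  · refine Finset.sum_congr rfl fun α _ => ?_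
    have hm : (0 : ℝ) < Nat.multinomial Finset.univ α := by
      exact_mod_cast Nat.multinomial_pos Finset.univ α
    rw [← Real.sqrt_mul (by positivity), eq_comm, Real.sqrt_eq_iff_mul_self_eq (by positivity)
      (norm_nonneg _)]
    simp only [norm_mul, norm_prod, norm_pow, ← pow_mul, mul_comm 2]
    simp only [pow_mul, Finset.prod_pow]
    field_simp
  · intro α; positivity
  · intro α; positivity

end PolySystem

theorem MvPolynomial.IsHomogeneous.eval_const_mul {ι : Type*} [Fintype ι] {p : MvPolynomial ι ℂ}
    {l : ℕ} (hp : p.IsHomogeneous l) (c : ℂ) (x : ι → ℂ) :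
    eval (fun j => c * x j) p = c ^ l * eval x p := by
  rw [eval_eq', eval_eq', Finset.mul_sum]
  refine Finset.sum_congr rfl fun α hα => ?_
  have h := hp (mem_support_iff.1 hα)
  rw [Finsupp.weight_apply, Finsupp.sum_fintype _ _ (by simp)] at h
  simp only [Pi.one_apply, smul_eq_mul, mul_one] at h
  simp only [mul_pow, Finset.prod_mul_distrib, Finset.prod_pow_eq_pow_sum, h]
  ring

/-! ### The normalized derivative and its relation to the condition number -/

namespace PolySystem

noncomputable section

variable {n : ℕ} {d : Fin n → ℕ}

theorem isHomogeneous_poly (f : PolySystem n d) (i : Fin n) : (f.poly i).IsHomogeneous (d i) :=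
  (f i).2

theorem jacobian_apply (f : PolySystem n d) (x v : EuclideanSpace ℂ (Fin (n + 1))) (i : Fin n) :
    f.jacobian x v i = MvPolynomial.eval (fun k => x k) ((f.poly i).dirDeriv v) := by
  rw [MvPolynomial.eval_dirDeriv]
  simp [jacobian, Matrix.mulVec, dotProduct]

/-- The scaling factor `dᵢ^{1/2} ‖x‖^{dᵢ - 1}` of the normalized condition number. -/
def scaling (d : Fin n → ℕ) (x : EuclideanSpace ℂ (Fin (n + 1))) (i : Fin n) : ℝ :=
  √(d i : ℝ) * ‖x‖ ^ (d i - 1)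

theorem scaling_pos (hd : ∀ i, 1 ≤ d i) {x : EuclideanSpace ℂ (Fin (n + 1))} (hx : x ≠ 0)
    (i : Fin n) : 0 < scaling d x i := by
  have := hd i
  have h1 : (0 : ℝ) < d i := by exact_mod_cast this
  have h2 : 0 < ‖x‖ := norm_pos_iff.2 hx
  unfold scaling
  positivity

/-- The derivative of a system, normalized in each component. -/
def normJacobian (f : PolySystem n d) (x : EuclideanSpace ℂ (Fin (n + 1))) :
    EuclideanSpace ℂ (Fin (n + 1)) →L[ℂ] EuclideanSpace ℂ (Fin n) :=
  (Matrix.toEuclideanCLM (𝕜 := ℂ)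
    (Matrix.diagonal fun i => (((scaling d x i)⁻¹ : ℝ) : ℂ))).comp (f.jacobian x)

theorem normJacobian_apply (f : PolySystem n d) (x v : EuclideanSpace ℂ (Fin (n + 1)))
    (i : Fin n) : f.normJacobian x v i =
      ((scaling d x i)⁻¹ : ℝ) * MvPolynomial.eval (fun k => x k) ((f.poly i).dirDeriv v) := by
  rw [← jacobian_apply]
  simp [normJacobian, Matrix.mulVec_diagonal]

theorem scaling_normJacobian (hd : ∀ i, 1 ≤ d i) (f : PolySystem n d)
    {x : EuclideanSpace ℂ (Fin (n + 1))} (hx : x ≠ 0) (v : EuclideanSpace ℂ (Fin (n + 1))) :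
    Matrix.toEuclideanCLM (𝕜 := ℂ) (Matrix.diagonal fun i : Fin n => ((scaling d x i : ℝ) : ℂ))
      (f.normJacobian x v) = f.jacobian x v := by
  ext i
  rw [Matrix.ofLp_toEuclideanCLM, Matrix.mulVec_diagonal, normJacobian_apply, jacobian_apply,
    ← mul_assoc, ← Complex.ofReal_mul, mul_inv_cancel₀ (scaling_pos hd hx i).ne']
  simp

theorem normJacobian_scaling (hd : ∀ i, 1 ≤ d i) (f : PolySystem n d)
    {x : EuclideanSpace ℂ (Fin (n + 1))} (hx : x ≠ 0) {v : EuclideanSpace ℂ (Fin (n + 1))}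
    {w : EuclideanSpace ℂ (Fin n)}
    (h : f.jacobian x v = Matrix.toEuclideanCLM (𝕜 := ℂ)
      (Matrix.diagonal fun i : Fin n => ((scaling d x i : ℝ) : ℂ)) w) :
    f.normJacobian x v = w := by
  ext i
  have h' := congrArg (fun u : EuclideanSpace ℂ (Fin n) => u i) h
  simp only [Matrix.ofLp_toEuclideanCLM, Matrix.mulVec_diagonal] at h'
  rw [normJacobian_apply, ← jacobian_apply, h', ← mul_assoc, ← Complex.ofReal_mul,
    inv_mul_cancel₀ (scaling_pos hd hx i).ne']
  simp

theorem finrank_orthogonal {x : EuclideanSpace ℂ (Fin (n + 1))} (hx : x ≠ 0) :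
    Module.finrank ℂ ((ℂ ∙ x)ᗮ : Submodule ℂ (EuclideanSpace ℂ (Fin (n + 1)))) = n := by
  have : Fact (Module.finrank ℂ (EuclideanSpace ℂ (Fin (n + 1))) = n + 1) := ⟨by simp⟩
  exact Submodule.finrank_orthogonal_span_singleton hx

theorem isInvertible_jacobianPerp (f : PolySystem n d) {x : EuclideanSpace ℂ (Fin (n + 1))}
    (hx : x ≠ 0) (h : Function.Injective (f.jacobianPerp x)) : (f.jacobianPerp x).IsInvertible := by
  have hfin : Module.finrank ℂ ((ℂ ∙ x)ᗮ : Submodule ℂ (EuclideanSpace ℂ (Fin (n + 1)))) =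
      Module.finrank ℂ (EuclideanSpace ℂ (Fin n)) := by
    rw [finrank_orthogonal hx]; simp
  refine ⟨(LinearEquiv.ofInjectiveOfFinrankEq
    ((f.jacobianPerp x : _ →L[ℂ] _) : _ →ₗ[ℂ] _) h hfin).toContinuousLinearEquiv, ?_⟩
  ext v : 1
  rfl

/-- A bound on the inverse is a lower bound on the map itself. Invertibility is part of the
equivalence: the lower bound gives injectivity on $x^\perp$, which has dimension `n`. All later work
on `muNorm` uses this form. -/
theorem muNorm_le_iff (hd : ∀ i, 1 ≤ d i) {f : PolySystem n d} (hf : f ≠ 0)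
    {x : EuclideanSpace ℂ (Fin (n + 1))} (hx : x ≠ 0) {M : ℝ} (hM : 0 ≤ M) :
    f.muNorm x ≤ ENNReal.ofReal M ↔
      ∀ v : EuclideanSpace ℂ (Fin (n + 1)), ⟪x, v⟫_ℂ = 0 →
        ‖f‖ * ‖v‖ ≤ M * ‖f.normJacobian x v‖ := by
  have hfn : 0 < ‖f‖ := norm_pos_iff.2 hf
  constructor
  · intro h v hv
    have hinv : (f.jacobianPerp x).IsInvertible := by
      by_contra hc
      rw [muNorm, if_neg hc] at h
      exact absurd h (by simp)
    rw [muNorm, if_pos hinv, ENNReal.ofReal_le_ofReal_iff hM] at h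
    set A := (f.jacobianPerp x).inverse.comp (Matrix.toEuclideanCLM (𝕜 := ℂ)
      (Matrix.diagonal fun i : Fin n => ((√(d i : ℝ) * ‖x‖ ^ (d i - 1) : ℝ) : ℂ))) with hA
    let v' : ((ℂ ∙ x)ᗮ : Submodule ℂ (EuclideanSpace ℂ (Fin (n + 1)))) :=
      ⟨v, Submodule.mem_orthogonal_singleton_iff_inner_right.2 hv⟩
    have h1 : A (f.normJacobian x v) = v' := by
      have h2 := scaling_normJacobian hd f hx v
      simp only [scaling] at h2
      rw [hA, ContinuousLinearMap.comp_apply, h2]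
      exact hinv.inverse_apply_self v'
    have h3 : ‖v‖ ≤ ‖A‖ * ‖f.normJacobian x v‖ := by
      have h4 := A.le_opNorm (f.normJacobian x v)
      rwa [h1] at h4
    calc ‖f‖ * ‖v‖ ≤ ‖f‖ * (‖A‖ * ‖f.normJacobian x v‖) := by gcongr
      _ = (‖f‖ * ‖A‖) * ‖f.normJacobian x v‖ := by ring
      _ ≤ _ := by gcongr
  · intro h
    have hinj : Function.Injective (f.jacobianPerp x) := by
      rw [injective_iff_map_eq_zero]
      intro v hv
      have h1 := h v (Submodule.mem_orthogonal_singleton_iff_inner_right.1 v.2)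
      have h2 : f.jacobian x v = 0 := hv
      rw [normJacobian, ContinuousLinearMap.comp_apply, h2, map_zero, norm_zero, mul_zero] at h1
      have h3 : ‖(v : EuclideanSpace ℂ (Fin (n + 1)))‖ ≤ 0 := by
        by_contra hc
        push Not at hc
        have := mul_pos hfn hc
        linarith
      exact Subtype.ext (norm_le_zero_iff.1 h3)
    have hinv := isInvertible_jacobianPerp f hx hinj
    rw [muNorm, if_pos hinv]
    refine ENNReal.ofReal_le_ofReal ?_
    rw [← le_div_iff₀' hfn]
    refine ContinuousLinearMap.opNorm_le_bound _ (by positivity) fun w => ?_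
    set B := Matrix.toEuclideanCLM (𝕜 := ℂ)
      (Matrix.diagonal fun i : Fin n => ((√(d i : ℝ) * ‖x‖ ^ (d i - 1) : ℝ) : ℂ))
    set v := (f.jacobianPerp x).inverse (B w) with hv
    have h1 : f.jacobian x v = B w := hinv.self_apply_inverse (B w)
    have h2 := h v (Submodule.mem_orthogonal_singleton_iff_inner_right.1 v.2)
    rw [normJacobian_scaling hd f hx (w := w) h1] at h2
    rw [ContinuousLinearMap.comp_apply, ← hv, div_mul_eq_mul_div, le_div_iff₀' hfn]
    exact h2

theorem eq_of_forall_le_ofReal_iff {a b : ℝ≥0∞}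
    (h : ∀ M : ℝ, 0 ≤ M → (a ≤ ENNReal.ofReal M ↔ b ≤ ENNReal.ofReal M)) : a = b := by
  refine le_antisymm ?_ ?_
  · rcases eq_or_ne b ∞ with rfl | hb
    · exact le_top
    · rw [← ENNReal.ofReal_toReal hb]
      exact (h _ ENNReal.toReal_nonneg).2 (by rw [ENNReal.ofReal_toReal hb])
  · rcases eq_or_ne a ∞ with rfl | ha
    · exact le_top
    · rw [← ENNReal.ofReal_toReal ha]
      exact (h _ ENNReal.toReal_nonneg).1 (by rw [ENNReal.ofReal_toReal ha])

theorem poly_smul (c : ℂ) (f : PolySystem n d) (i : Fin n) : (c • f).poly i = c • f.poly i := rfl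

theorem poly_sub (f g : PolySystem n d) (i : Fin n) : (f - g).poly i = f.poly i - g.poly i := rfl

theorem normJacobian_smul_left (c : ℂ) (f : PolySystem n d)
    (x v : EuclideanSpace ℂ (Fin (n + 1))) :
    (c • f).normJacobian x v = c • f.normJacobian x v := by
  ext i
  simp only [normJacobian_apply, PiLp.smul_apply, poly_smul, smul_eq_mul,
    MvPolynomial.eval_dirDeriv, Derivation.map_smul, MvPolynomial.smul_eval, Finset.mul_sum]
  exact Finset.sum_congr rfl fun j _ => by ring

theorem normJacobian_sub_left (f g : PolySystem n d)
    (x v : EuclideanSpace ℂ (Fin (n + 1))) :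
    (f - g).normJacobian x v = f.normJacobian x v - g.normJacobian x v := by
  ext i
  simp only [normJacobian_apply, PiLp.sub_apply, poly_sub, MvPolynomial.eval_dirDeriv, map_sub,
    sub_mul, Finset.sum_sub_distrib, mul_sub]

/-- Component `i` of the derivative picks up $c^{d_i-1}$ and the scaling divides by $|c|^{d_i-1}$.
The remaining phases depend on `i`, so only the norm is invariant. -/
theorem norm_normJacobian_smul_right {c : ℂ} (hc : c ≠ 0) (f : PolySystem n d)
    (x v : EuclideanSpace ℂ (Fin (n + 1))) :
    ‖f.normJacobian (c • x) v‖ = ‖f.normJacobian x v‖ := by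
  have hcn : ‖c‖ ≠ 0 := norm_ne_zero_iff.2 hc
  rw [EuclideanSpace.norm_eq, EuclideanSpace.norm_eq]
  congr 1
  refine Finset.sum_congr rfl fun i _ => ?_
  congr 1
  have h : MvPolynomial.eval (fun k => (c • x) k) ((f.poly i).dirDeriv v) =
      c ^ (d i - 1) * MvPolynomial.eval (fun k => x k) ((f.poly i).dirDeriv v) := by
    rw [MvPolynomial.eval_dirDeriv, MvPolynomial.eval_dirDeriv, Finset.mul_sum]
    refine Finset.sum_congr rfl fun j _ => ?_
    have := (f.isHomogeneous_poly i).pderiv (i := j) |>.eval_const_mul c (fun k => x k)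
    simp only [PiLp.smul_apply, smul_eq_mul, this]
    ring
  rw [normJacobian_apply, normJacobian_apply, h, norm_mul, norm_mul, norm_mul, norm_pow,
    Complex.norm_real, Complex.norm_real, scaling, scaling, norm_smul, mul_pow, norm_inv, norm_inv,
    norm_mul, norm_mul, norm_mul, norm_pow, norm_norm]
  field_simp

theorem muNorm_smul_left (hd : ∀ i, 1 ≤ d i) {f : PolySystem n d} (hf : f ≠ 0)
    {x : EuclideanSpace ℂ (Fin (n + 1))} (hx : x ≠ 0) {c : ℂ} (hc : c ≠ 0) :
    (c • f).muNorm x = f.muNorm x := by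
  have hcn : 0 < ‖c‖ := norm_pos_iff.2 hc
  refine eq_of_forall_le_ofReal_iff fun M hM => ?_
  rw [muNorm_le_iff hd hf hx hM, muNorm_le_iff hd (smul_ne_zero hc hf) hx hM]
  refine forall₂_congr fun v _ => ?_
  rw [normJacobian_smul_left, norm_smul, norm_smul, mul_assoc, mul_left_comm M,
    mul_le_mul_iff_right₀ hcn]

theorem muNorm_smul_right (hd : ∀ i, 1 ≤ d i) {f : PolySystem n d} (hf : f ≠ 0)
    {x : EuclideanSpace ℂ (Fin (n + 1))} (hx : x ≠ 0) {c : ℂ} (hc : c ≠ 0) :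
    f.muNorm (c • x) = f.muNorm x := by
  refine eq_of_forall_le_ofReal_iff fun M hM => ?_
  rw [muNorm_le_iff hd hf hx hM, muNorm_le_iff hd hf (smul_ne_zero hc hx) hM]
  refine forall_congr' fun v => ?_
  rw [norm_normJacobian_smul_right hc, inner_smul_left, mul_eq_zero_iff_left (by simpa using hc)]

/-! ### Lipschitz estimate for the condition number -/

theorem ne_zero_of_system_ne_zero {f : PolySystem n d} (hf : f ≠ 0) : n ≠ 0 := by
  rintro rfl
  exact hf (funext fun i => i.elim0)

theorem le_maxDegree (i : Fin n) : (d i : ℝ) ≤ maxDegree d := by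
  exact_mod_cast Finset.le_sup (f := d) (Finset.mem_univ i)

theorem one_le_maxDegree (hd : ∀ i, 1 ≤ d i) (hn : n ≠ 0) : (1 : ℝ) ≤ maxDegree d := by
  have h1 := hd ⟨0, Nat.pos_of_ne_zero hn⟩
  have h2 := le_maxDegree (d := d) ⟨0, Nat.pos_of_ne_zero hn⟩
  have h3 : (1 : ℝ) ≤ d ⟨0, Nat.pos_of_ne_zero hn⟩ := by exact_mod_cast h1
  linarith

theorem rpow_three_half {a : ℝ} (ha : 0 ≤ a) : a ^ (3 / 2 : ℝ) = a * √a := by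
  rcases eq_or_lt_of_le ha with rfl | ha
  · simp
  · rw [Real.sqrt_eq_rpow, ← Real.rpow_one_add' ha.le (by norm_num)]
    norm_num

theorem inv_sqrt_mul_sq_le {a b : ℝ} (ha : 0 < a) (hab : a ≤ b) :
    (√a)⁻¹ * a ^ 2 ≤ b ^ (3 / 2 : ℝ) := by
  rw [rpow_three_half (ha.le.trans hab)]
  have h : (√a)⁻¹ * a ^ 2 = a * √a := by
    have := Real.mul_self_sqrt ha.le
    have h0 : 0 < √a := Real.sqrt_pos.2 ha
    field_simp
    nlinarith
  rw [h]
  gcongr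
  exact ha.le.trans hab

theorem scaling_of_norm_eq_one {x : EuclideanSpace ℂ (Fin (n + 1))} (hx : ‖x‖ = 1) (i : Fin n) :
    scaling d x i = √(d i : ℝ) := by
  simp [scaling, hx]

theorem norm_normJacobian_le (hd : ∀ i, 1 ≤ d i) (f : PolySystem n d)
    {x : EuclideanSpace ℂ (Fin (n + 1))} (hx : ‖x‖ = 1) (v : EuclideanSpace ℂ (Fin (n + 1))) :
    ‖f.normJacobian x v‖ ≤ 8 * (maxDegree d : ℝ) ^ (3 / 2 : ℝ) * ‖v‖ * ‖f‖ := by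
  refine norm_le_of_forall_norm_le f (by positivity) fun i => ?_
  have hdi : (1 : ℝ) ≤ d i := by exact_mod_cast hd i
  have h := MvPolynomial.norm_eval_dirDeriv_le_of_norm_le (hd i) (f.polyNorm_nonneg i)
    (f.norm_eval_poly_le i) (x := x) (by rw [hx]; simp) v
  rw [normJacobian_apply, norm_mul, Complex.norm_real, scaling_of_norm_eq_one hx, norm_inv,
    Real.norm_of_nonneg (Real.sqrt_nonneg _)]
  have hN := f.polyNorm_nonneg i
  calc (√(d i : ℝ))⁻¹ * ‖MvPolynomial.eval (fun k => x k) ((f.poly i).dirDeriv v)‖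
      ≤ (√(d i : ℝ))⁻¹ * (8 * d i * f.polyNorm i * ‖v‖) := by gcongr
    _ ≤ (√(d i : ℝ))⁻¹ * (8 * (d i : ℝ) ^ 2 * f.polyNorm i * ‖v‖) := by
        gcongr
        nlinarith
    _ = 8 * ((√(d i : ℝ))⁻¹ * (d i : ℝ) ^ 2) * ‖v‖ * f.polyNorm i := by ring
    _ ≤ _ := by
        gcongr
        exact inv_sqrt_mul_sq_le (by linarith) (le_maxDegree i)

theorem norm_normJacobian_sub_le (hd : ∀ i, 1 ≤ d i) (f : PolySystem n d)
    {x y : EuclideanSpace ℂ (Fin (n + 1))} (hx : ‖x‖ = 1) (hy : ‖y‖ = 1)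
    (v : EuclideanSpace ℂ (Fin (n + 1))) :
    ‖f.normJacobian x v - f.normJacobian y v‖ ≤
      8 * (maxDegree d : ℝ) ^ (3 / 2 : ℝ) * ‖v‖ * ‖x - y‖ * ‖f‖ := by
  refine norm_le_of_forall_norm_le f (by positivity) fun i => ?_
  have hdi : (1 : ℝ) ≤ d i := by exact_mod_cast hd i
  have h := MvPolynomial.norm_eval_dirDeriv_sub_le (hd i) (f.polyNorm_nonneg i)
    (f.norm_eval_poly_le i) hy.le hx.le v
  rw [PiLp.sub_apply, normJacobian_apply, normJacobian_apply, scaling_of_norm_eq_one hx,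
    scaling_of_norm_eq_one hy, ← mul_sub, norm_mul, Complex.norm_real, norm_inv,
    Real.norm_of_nonneg (Real.sqrt_nonneg _)]
  have hN := f.polyNorm_nonneg i
  calc (√(d i : ℝ))⁻¹ * ‖MvPolynomial.eval (fun k => x k) ((f.poly i).dirDeriv v) -
        MvPolynomial.eval (fun k => y k) ((f.poly i).dirDeriv v)‖
      ≤ (√(d i : ℝ))⁻¹ * (8 * (d i : ℝ) ^ 2 * f.polyNorm i * ‖v‖ * ‖x - y‖) := by gcongr
    _ = 8 * ((√(d i : ℝ))⁻¹ * (d i : ℝ) ^ 2) * ‖v‖ * ‖x - y‖ * f.polyNorm i := by ring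
    _ ≤ _ := by
        gcongr
        exact inv_sqrt_mul_sq_le (by linarith) (le_maxDegree i)

/-- Euler's identity: at a zero, the derivative kills the radial direction. -/
theorem normJacobian_self {f : PolySystem n d} {x : EuclideanSpace ℂ (Fin (n + 1))}
    (h : f.eval x = 0) : f.normJacobian x x = 0 := by
  ext i
  have h1 : MvPolynomial.eval (fun k => x k) (f.poly i) = 0 :=
    congrArg (fun u : EuclideanSpace ℂ (Fin n) => u i) h
  have h2 := congrArg (MvPolynomial.eval fun k => x k) (f.isHomogeneous_poly i).sum_X_mul_pderiv
  simp only [map_sum, map_mul, MvPolynomial.eval_X, map_nsmul, h1, smul_zero] at h2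
  rw [normJacobian_apply, MvPolynomial.eval_dirDeriv]
  simp only [mul_comm] at h2 ⊢
  rw [h2]
  simp

/-- `μ_norm` is bounded below. -/
theorem one_le_mul_of_muNorm_le (hd : ∀ i, 1 ≤ d i) {f : PolySystem n d} (hf : ‖f‖ = 1)
    {x : EuclideanSpace ℂ (Fin (n + 1))} (hx : ‖x‖ = 1) {M : ℝ} (hM : 0 ≤ M)
    (h : f.muNorm x ≤ ENNReal.ofReal M) : 1 ≤ 8 * (maxDegree d : ℝ) ^ (3 / 2 : ℝ) * M := by
  have hf0 : f ≠ 0 := norm_ne_zero_iff.1 (by rw [hf]; exact one_ne_zero)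
  have hx0 : x ≠ 0 := norm_ne_zero_iff.1 (by rw [hx]; exact one_ne_zero)
  have hpos : 0 < Module.finrank ℂ
      ((ℂ ∙ x)ᗮ : Submodule ℂ (EuclideanSpace ℂ (Fin (n + 1)))) := by
    rw [finrank_orthogonal hx0]
    exact Nat.pos_of_ne_zero (ne_zero_of_system_ne_zero hf0)
  obtain ⟨v, hv⟩ := Module.finrank_pos_iff_exists_ne_zero.1 hpos
  have hvn : 0 < ‖(v : EuclideanSpace ℂ (Fin (n + 1)))‖ := by
    simpa using hv
  have h1 := (muNorm_le_iff hd hf0 hx0 hM).1 h v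
    (Submodule.mem_orthogonal_singleton_iff_inner_right.1 v.2)
  have h2 := norm_normJacobian_le hd f hx (v : EuclideanSpace ℂ (Fin (n + 1)))
  rw [hf, mul_one] at h2
  rw [hf, one_mul] at h1
  have h3 := mul_le_mul_of_nonneg_left h2 hM
  by_contra hc
  push Not at hc
  nlinarith

/-- `1 / μ_norm` is Lipschitz on the solution variety, with a constant of order `D^{3/2}`. -/
theorem muNorm_le_of_norm_sub_le (hd : ∀ i, 1 ≤ d i) {f g : PolySystem n d} (hf : ‖f‖ = 1)
    (hg : ‖g‖ = 1) {x y : EuclideanSpace ℂ (Fin (n + 1))} (hx : ‖x‖ = 1) (hy : ‖y‖ = 1)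
    (hfx : f.eval x = 0) {M η : ℝ} (hM : 0 ≤ M) (h : f.muNorm x ≤ ENNReal.ofReal M) (hη : η < 1)
    (hdist : 16 * (maxDegree d : ℝ) ^ (3 / 2 : ℝ) * M * (‖f - g‖ + ‖x - y‖) ≤ η) :
    g.muNorm y ≤ ENNReal.ofReal (M / (1 - η)) := by
  have hf0 : f ≠ 0 := norm_ne_zero_iff.1 (by rw [hf]; exact one_ne_zero)
  have hx0 : x ≠ 0 := norm_ne_zero_iff.1 (by rw [hx]; exact one_ne_zero)
  have hg0 : g ≠ 0 := norm_ne_zero_iff.1 (by rw [hg]; exact one_ne_zero)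
  have hy0 : y ≠ 0 := norm_ne_zero_iff.1 (by rw [hy]; exact one_ne_zero)
  have hη1 : 0 < 1 - η := by linarith
  rw [muNorm_le_iff hd hg0 hy0 (by positivity)]
  intro v hv
  set r := (maxDegree d : ℝ) ^ (3 / 2 : ℝ)
  have hr : 0 ≤ r := by positivity
  -- The complements of `x` and `y` differ. Projecting `v` to $x^\perp$ does not change the image
  -- under the derivative of `f`, since `x` lies in its kernel, and shortens `v` by at most
  -- $\|x-y\|\|v\|$.
  set v' := v - ⟪x, v⟫_ℂ • x with hv'
  have hxv : ⟪x, v'⟫_ℂ = 0 := by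
    rw [hv', inner_sub_right, inner_smul_right, inner_self_eq_norm_sq_to_K, hx]
    simp
  have hin : ‖⟪x, v⟫_ℂ‖ ≤ ‖x - y‖ * ‖v‖ := by
    have : ⟪x, v⟫_ℂ = ⟪x - y, v⟫_ℂ := by rw [inner_sub_left, hv, sub_zero]
    rw [this]
    exact norm_inner_le_norm _ _
  have hvv : ‖v‖ - ‖x - y‖ * ‖v‖ ≤ ‖v'‖ := by
    have h1 := norm_sub_norm_le v (⟪x, v⟫_ℂ • x)
    rw [norm_smul, hx, mul_one] at h1
    linarith
  have hW : f.normJacobian x v' = f.normJacobian x v := by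
    rw [hv', map_sub, map_smul, normJacobian_self hfx, smul_zero, sub_zero]
  have h1 := (muNorm_le_iff hd hf0 hx0 hM).1 h v' hxv
  rw [hf, one_mul, hW] at h1
  have h2 : ‖f.normJacobian x v‖ ≤
      ‖g.normJacobian y v‖ + 8 * r * (‖f - g‖ + ‖x - y‖) * ‖v‖ := by
    have e : f.normJacobian x v = g.normJacobian y v + ((f - g).normJacobian x v +
        (g.normJacobian x v - g.normJacobian y v)) := by
      rw [normJacobian_sub_left]; abel
    have e1 := norm_normJacobian_le hd (f - g) hx v
    have e2 := norm_normJacobian_sub_le hd g hx hy v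
    rw [hg] at e2
    rw [e]
    refine (norm_add_le _ _).trans ?_
    have e3 := norm_add_le ((f - g).normJacobian x v)
      (g.normJacobian x v - g.normJacobian y v)
    linarith
  have h3 := one_le_mul_of_muNorm_le hd hf hx hM h
  have h4 := mul_le_mul_of_nonneg_left h2 hM
  -- The projection loss carries no factor `r * M`; the lower bound $1\le 8rM$ supplies it. This
  -- doubles the 8 of the derivative estimates to the 16 of the hypothesis.
  have h5 : ‖x - y‖ * ‖v‖ ≤ 8 * r * M * (‖x - y‖ * ‖v‖) :=
    le_mul_of_one_le_left (by positivity) h3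
  have h6 : 8 * r * M * (‖x - y‖ * ‖v‖) ≤ 8 * r * M * (‖f - g‖ + ‖x - y‖) * ‖v‖ := by
    have : 0 ≤ 8 * r * M * ‖f - g‖ * ‖v‖ := by positivity
    linarith
  have h7 := mul_le_mul_of_nonneg_right hdist (norm_nonneg v)
  rw [hg, one_mul, div_mul_eq_mul_div, le_div_iff₀ hη1]
  linarith

end

end PolySystem

/-! ### Horizontal unit lifts of projective curves -/

section Lift

open Set MeasureTheory

/-- Extending by constants beyond the endpoints makes the fundamental theorem of calculus available
at every point. The last clause transfers properties of values, such as nonnegativity. -/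
theorem ContinuousOn.exists_continuous_eqOn_Icc {β : Type*} [TopologicalSpace β] {f : ℝ → β}
    {a b : ℝ} (h : a ≤ b) (hf : ContinuousOn f (Icc a b)) :
    ∃ F : ℝ → β, Continuous F ∧ EqOn F f (Icc a b) ∧ ∀ t, ∃ s, F t = f s :=
  ⟨IccExtend h ((Icc a b).domRestrict f), (continuousOn_iff_continuous_domRestrict.1 hf).Icc_extend',
    fun t ht => by rw [IccExtend_of_mem h _ ht]; rfl, fun t => ⟨projIcc a b h t, rfl⟩⟩

variable {E : Type*} [NormedAddCommGroup E] [InnerProductSpace ℂ E]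

theorem projNorm_eq (x v : E) :
    projNorm x v = ‖v - (⟪x, v⟫_ℂ / ((‖x‖ ^ 2 : ℝ) : ℂ)) • x‖ / ‖x‖ := by
  rw [projNorm, Submodule.starProjection_orthogonal_val, Submodule.starProjection_singleton]
  rfl

theorem projNorm_nonneg (x v : E) : 0 ≤ projNorm x v := by
  unfold projNorm
  positivity

theorem ContinuousOn.projNorm {γ γ' : ℝ → E} {s : Set ℝ} (h : ContinuousOn γ s)
    (h' : ContinuousOn γ' s) (hne : ∀ t ∈ s, γ t ≠ 0) :
    ContinuousOn (fun t => projNorm (γ t) (γ' t)) s := by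
  simp only [projNorm_eq]
  have h1 : ContinuousOn (fun t => (((‖γ t‖ ^ 2 : ℝ)) : ℂ)) s :=
    Complex.continuous_ofReal.comp_continuousOn (h.norm.pow 2)
  refine ContinuousOn.div (h'.sub (((ContinuousOn.inner (𝕜 := ℂ) h h').div h1 ?_).smul h)).norm h.norm ?_
  · intro t ht
    have := norm_ne_zero_iff.2 (hne t ht)
    exact_mod_cast pow_ne_zero 2 this
  · intro t ht
    exact norm_ne_zero_iff.2 (hne t ht)

/-- A curve of nonzero vectors can be rescaled to a horizontal curve of unit vectors. -/
theorem exists_unit_lift {t₀ t₁ : ℝ} (h01 : t₀ < t₁) {γ : ℝ → E}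
    (hγ : ContDiffOn ℝ 1 γ (Icc t₀ t₁)) (hne : ∀ t ∈ Icc t₀ t₁, γ t ≠ 0) :
    ∃ c : ℝ → ℂ, (∀ t, c t ≠ 0) ∧ (∀ t ∈ Icc t₀ t₁, ‖c t • γ t‖ = 1) ∧
      ∀ V : ℝ → ℝ, Continuous V →
        (∀ t ∈ Icc t₀ t₁, projNorm (γ t) (derivWithin γ (Icc t₀ t₁) t) ≤ V t) →
        ∀ a ∈ Icc t₀ t₁, ∀ b ∈ Icc t₀ t₁, a ≤ b →
          ‖c b • γ b - c a • γ a‖ ≤ ∫ t in a..b, V t := by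
  set γ' := derivWithin γ (Icc t₀ t₁) with hγ'
  have hγc := hγ.continuousOn
  have hγ'c : ContinuousOn γ' (Icc t₀ t₁) :=
    hγ.continuousOn_derivWithin (uniqueDiffOn_Icc h01) le_rfl
  have hd : ∀ t ∈ Icc t₀ t₁, HasDerivWithinAt γ (γ' t) (Icc t₀ t₁) t := fun t ht =>
    (hγ.differentiableOn one_ne_zero t ht).hasDerivWithinAt
  have hφc : ContinuousOn (fun t => ⟪γ t, γ' t⟫_ℂ / ((‖γ t‖ ^ 2 : ℝ) : ℂ)) (Icc t₀ t₁) := by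
    refine (ContinuousOn.inner (𝕜 := ℂ) hγc hγ'c).div
      (Complex.continuous_ofReal.comp_continuousOn (hγc.norm.pow 2)) fun t ht => ?_
    have := norm_ne_zero_iff.2 (hne t ht)
    exact_mod_cast pow_ne_zero 2 this
  obtain ⟨ψ, hψc, hψ, -⟩ := hφc.exists_continuous_eqOn_Icc h01.le
  have h0 : t₀ ∈ Icc t₀ t₁ := left_mem_Icc.2 h01.le
  have hn0 : ‖γ t₀‖ ≠ 0 := norm_ne_zero_iff.2 (hne t₀ h0)
  -- Solves $c'=-\psi c$ with $\psi=\langle\gamma,\gamma'\rangle/\|\gamma\|^2$, so that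
  -- $(c\gamma)'=c(\gamma'-\psi\gamma)$ is orthogonal to $\gamma$. The norm of $c\gamma$ is then
  -- constant, and its speed is the Fubini-Study speed.
  set c : ℝ → ℂ := fun t => Complex.exp (-∫ s in t₀..t, ψ s) * ((‖γ t₀‖⁻¹ : ℝ) : ℂ) with hc
  have hcd : ∀ t, HasDerivAt c (-ψ t * c t) t := fun t => by
    have h1 := ((hψc.integral_hasStrictDerivAt t₀ t).hasDerivAt.neg.cexp).mul_const
      ((‖γ t₀‖⁻¹ : ℝ) : ℂ)
    refine h1.congr_deriv ?_
    simp only [hc, Pi.neg_apply]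
    ring
  have hc0 : ∀ t, c t ≠ 0 := fun t =>
    mul_ne_zero (Complex.exp_ne_zero _) (by exact_mod_cast inv_ne_zero hn0)
  set u : ℝ → E := fun t => c t • γ t with hu
  set u' : ℝ → E := fun t => c t • (γ' t - ψ t • γ t) with hu'
  have hud : ∀ t ∈ Icc t₀ t₁, HasDerivWithinAt u (u' t) (Icc t₀ t₁) t := fun t ht => by
    refine ((hcd t).hasDerivWithinAt.smul (hd t ht)).congr_deriv ?_
    simp only [hu']
    module
  have huc : ContinuousOn u (Icc t₀ t₁) := fun t ht => (hud t ht).continuousWithinAt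
  have horth : ∀ t ∈ Icc t₀ t₁, ⟪u t, u' t⟫_ℂ = 0 := fun t ht => by
    have hn : ((‖γ t‖ : ℝ) : ℂ) ≠ 0 := by exact_mod_cast norm_ne_zero_iff.2 (hne t ht)
    simp only [hu, hu', inner_smul_left, inner_smul_right, inner_sub_right,
      inner_self_eq_norm_sq_to_K, hψ ht]
    push_cast
    simp only [Complex.coe_algebraMap]
    field_simp
    ring
  have hright : ∀ t ∈ Ico t₀ t₁, HasDerivWithinAt u (u' t) (Ici t) t := fun t ht =>
    (hud t (Ico_subset_Icc_self ht)).mono_of_mem_nhdsWithin (Icc_mem_nhdsGE_of_mem ht)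
  have hnorm : ∀ t ∈ Icc t₀ t₁, ‖u t‖ = 1 := by
    let _ : InnerProductSpace ℝ E := InnerProductSpace.complexToReal
    have h1 := constant_of_has_deriv_right_zero (f := fun t => ‖u t‖ ^ 2) (huc.norm.pow 2)
      fun t ht => by
        refine (hright t ht).norm_sq.congr_deriv ?_
        rw [real_inner_eq_re_inner ℂ, horth t (Ico_subset_Icc_self ht)]
        simp
    intro t ht
    have h2 : ‖u t₀‖ = 1 := by
      simp only [hu, hc, norm_smul, intervalIntegral.integral_same, neg_zero,
        Complex.exp_zero, one_mul, Complex.norm_real, norm_inv, norm_norm]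
      exact inv_mul_cancel₀ hn0
    have h3 := h1 t ht
    rw [h2, one_pow] at h3
    exact (pow_eq_one_iff_of_nonneg (norm_nonneg _) two_ne_zero).1 h3
  have hspeed : ∀ t ∈ Icc t₀ t₁, ‖u' t‖ = projNorm (γ t) (γ' t) := fun t ht => by
    have h1 := hnorm t ht
    have hn : ‖γ t‖ ≠ 0 := norm_ne_zero_iff.2 (hne t ht)
    simp only [hu, norm_smul] at h1
    have h2 : ⟪γ t, γ' t⟫_ℂ / ((‖γ t‖ ^ 2 : ℝ) : ℂ) = ψ t := (hψ ht).symm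
    rw [projNorm_eq, h2, hu', norm_smul, eq_div_iff hn]
    linear_combination ‖γ' t - ψ t • γ t‖ * h1
  refine ⟨c, hc0, hnorm, fun V hV hle a ha b hb hab => ?_⟩
  have hsub : Icc a b ⊆ Icc t₀ t₁ := Icc_subset_Icc ha.1 hb.2
  refine image_norm_le_of_norm_deriv_right_le_deriv_boundary (f := fun t => u t - u a) (a := a)
    (b := b) (f' := u') ((huc.mono hsub).sub continuousOn_const) (fun t ht => ?_)
    (B := fun t => ∫ s in a..t, V s) (B' := V) (by simp)
    (fun t => (hV.integral_hasStrictDerivAt a t).hasDerivAt) (fun t ht => ?_)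
    (right_mem_Icc.2 hab)
  · exact (hright t ⟨ha.1.trans ht.1, ht.2.trans_le hb.2⟩).sub_const (u a)
  · rw [hspeed t (hsub (Ico_subset_Icc_self ht))]
    exact hle t (hsub (Ico_subset_Icc_self ht))

end Lift

/-! ### The condition number along a path -/

section Path

open Set MeasureTheory

variable {n : ℕ} {d : Fin n → ℕ} {t₀ t₁ : ℝ} {f : ℝ → PolySystem n d}
  {ζ : ℝ → EuclideanSpace ℂ (Fin (n + 1))}

theorem pathSpeed_nonneg (t : ℝ) : 0 ≤ pathSpeed t₀ t₁ f ζ t :=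
  add_nonneg (projNorm_nonneg _ _) (projNorm_nonneg _ _)

/-- At an isolated point of the domain `derivWithin` has the default value 0. -/
theorem pathSpeed_eq_zero_of_subsingleton (t : ℝ) : pathSpeed t₀ t₀ f ζ t = 0 := by
  have h : ¬AccPt t (Filter.principal (Icc t₀ t₀)) := fun h =>
    Set.Infinite.of_accPt h (by rw [Icc_self]; exact Set.finite_singleton t₀)
  simp only [pathSpeed, projNorm, derivWithin_zero_of_not_accPt h, map_zero, norm_zero, zero_div,
    add_zero]

theorem IsC1SolutionPath.continuousOn_pathSpeed (h01 : t₀ < t₁)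
    (h : IsC1SolutionPath t₀ t₁ f ζ) : ContinuousOn (pathSpeed t₀ t₁ f ζ) (Icc t₀ t₁) :=
  (h.contDiffOn_system.continuousOn.projNorm (h.contDiffOn_system.continuousOn_derivWithin
    (uniqueDiffOn_Icc h01) le_rfl) h.system_ne_zero).add
  (h.contDiffOn_zero.continuousOn.projNorm (h.contDiffOn_zero.continuousOn_derivWithin
    (uniqueDiffOn_Icc h01) le_rfl) h.zero_ne_zero)

theorem PolySystem.eval_smul_smul {g : PolySystem n d} {x : EuclideanSpace ℂ (Fin (n + 1))}
    (h : g.eval x = 0) (a b : ℂ) : (a • g).eval (b • x) = 0 := by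
  ext i
  have h1 : MvPolynomial.eval (fun k => x k) (g.poly i) = 0 :=
    congrArg (fun u : EuclideanSpace ℂ (Fin n) => u i) h
  have h2 := (g.isHomogeneous_poly i).eval_const_mul b (fun k => x k)
  simp only [PolySystem.eval, PolySystem.poly_smul, PiLp.smul_apply, smul_eq_mul,
    MvPolynomial.smul_eval, h2, h1, mul_zero, PiLp.zero_apply]

/-- Along a path in the solution variety, `1 / μ_norm` is Lipschitz with respect to arc length. -/
theorem IsC1SolutionPath.muNorm_le (hd : ∀ i, 1 ≤ d i) (h01 : t₀ < t₁)
    (h : IsC1SolutionPath t₀ t₁ f ζ) {V : ℝ → ℝ} (hV : Continuous V)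
    (hVs : EqOn V (pathSpeed t₀ t₁ f ζ) (Icc t₀ t₁)) {s t : ℝ} (hs : s ∈ Icc t₀ t₁)
    (ht : t ∈ Icc t₀ t₁) {M η : ℝ} (hM : 0 ≤ M) (hμ : (f s).muNorm (ζ s) ≤ ENNReal.ofReal M)
    (hη : η < 1)
    (hdist : 16 * (maxDegree d : ℝ) ^ (3 / 2 : ℝ) * M * |∫ τ in s..t, V τ| ≤ η) :
    (f t).muNorm (ζ t) ≤ ENNReal.ofReal (M / (1 - η)) := by
  obtain ⟨a, ha0, ha1, ha⟩ := exists_unit_lift h01 h.contDiffOn_system h.system_ne_zero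
  obtain ⟨b, hb0, hb1, hb⟩ := exists_unit_lift h01 h.contDiffOn_zero h.zero_ne_zero
  -- `F` is the speed of the system and `V - F` that of the zero; the two chord bounds add up to the
  -- integral of `V`.
  obtain ⟨F, hF, hFs, -⟩ := (h.contDiffOn_system.continuousOn.projNorm
    (h.contDiffOn_system.continuousOn_derivWithin (uniqueDiffOn_Icc h01) le_rfl)
    h.system_ne_zero).exists_continuous_eqOn_Icc h01.le
  have key : ∀ p ∈ Icc t₀ t₁, ∀ q ∈ Icc t₀ t₁, p ≤ q →
      ‖a q • f q - a p • f p‖ + ‖b q • ζ q - b p • ζ p‖ ≤ ∫ τ in p..q, V τ := by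
    intro p hp q hq hpq
    have h1 := ha F hF (fun t ht => (hFs ht).ge) p hp q hq hpq
    have h2 := hb (fun t => V t - F t) (hV.sub hF) (fun t ht => by
      simp only [hVs ht, hFs ht, pathSpeed, add_sub_cancel_left, le_refl]) p hp q hq hpq
    rw [intervalIntegral.integral_sub (hV.intervalIntegrable _ _) (hF.intervalIntegrable _ _)] at h2
    linarith
  have key' : ‖a s • f s - a t • f t‖ + ‖b s • ζ s - b t • ζ t‖ ≤ |∫ τ in s..t, V τ| := by
    rcases le_total s t with hst | hst
    · rw [norm_sub_rev, norm_sub_rev (b s • ζ s)]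
      exact (key s hs t ht hst).trans (le_abs_self _)
    · rw [intervalIntegral.integral_symm, abs_neg]
      exact (key t ht s hs hst).trans (le_abs_self _)
  have hmu : ∀ τ ∈ Icc t₀ t₁, (a τ • f τ).muNorm (b τ • ζ τ) = (f τ).muNorm (ζ τ) := by
    intro τ hτ
    rw [PolySystem.muNorm_smul_left hd (h.system_ne_zero τ hτ)
      (smul_ne_zero (hb0 τ) (h.zero_ne_zero τ hτ)) (ha0 τ),
      PolySystem.muNorm_smul_right hd (h.system_ne_zero τ hτ) (h.zero_ne_zero τ hτ) (hb0 τ)]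
  rw [← hmu t ht]
  rw [← hmu s hs] at hμ
  refine PolySystem.muNorm_le_of_norm_sub_le hd (ha1 s hs) (ha1 t ht) (hb1 s hs) (hb1 t ht)
    (PolySystem.eval_smul_smul (h.eval_eq_zero s hs) _ _) hM hμ hη (le_trans ?_ hdist)
  gcongr

end Path

/-! ### Greedy subdivision for an abstract speed and condition function -/

section Greedy

open Set MeasureTheory

variable {V : ℝ → ℝ} {t₀ t₁ : ℝ} {μ : ℝ → ℝ≥0∞} {r C q Q : ℝ} {S : ℕ → ℝ}

theorem setLIntegral_Icc_ofReal (hV : Continuous V) (hV0 : ∀ t, 0 ≤ V t) {a b : ℝ} (hab : a ≤ b) :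
    ∫⁻ t in Icc a b, ENNReal.ofReal (V t) = ENNReal.ofReal (∫ t in a..b, V t) := by
  rw [intervalIntegral.integral_of_le hab, ← integral_Icc_eq_integral_Ioc,
    ofReal_integral_eq_lintegral_ofReal (hV.integrableOn_Icc) (Filter.Eventually.of_forall hV0)]

theorem Continuous.integral_interval (hV : Continuous V) (a : ℝ) :
    Continuous fun t => ∫ s in a..t, V s :=
  continuous_iff_continuousAt.2 fun t =>
    (hV.integral_hasStrictDerivAt a t).hasDerivAt.continuousAt

/-- Each step ends at the first time at which the length `ofReal C / (ofReal r * μ)` is reached, or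
at `t₁`. -/
def IsGreedyStep (V : ℝ → ℝ) (μ : ℝ → ℝ≥0∞) (r C t₁ s s' : ℝ) : Prop :=
  IsLeast {t : ℝ | t ∈ Icc s t₁ ∧
    (ENNReal.ofReal (∫ τ in s..t, V τ) = ENNReal.ofReal C / (ENNReal.ofReal r * μ s) ∨ t = t₁)} s'

theorem exists_isGreedyStep (hV : Continuous V) (μ : ℝ → ℝ≥0∞) (r C : ℝ) {s : ℝ} (hs : s ≤ t₁) :
    ∃ s', IsGreedyStep V μ r C t₁ s s' := by
  refine IsCompact.exists_isLeast ?_ ⟨t₁, right_mem_Icc.2 hs, Or.inr rfl⟩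
  refine isCompact_Icc.inter_right (t := {t | _ ∨ t = t₁}) ?_
  exact (isClosed_eq (ENNReal.continuous_ofReal.comp (hV.integral_interval s))
    continuous_const).union (isClosed_eq continuous_id continuous_const)

/-- If the piece were too long, the intermediate value theorem would give an earlier time with
exactly the prescribed length. -/
theorem IsGreedyStep.mul_le (hV : Continuous V) (hC : 0 < C) (hr : 0 < r) {s s' : ℝ}
    (h : IsGreedyStep V μ r C t₁ s s') (hμ : μ s ≠ ∞) :
    r * (μ s).toReal * ∫ τ in s..s', V τ ≤ C := by
  by_contra hc
  push Not at hc
  obtain ⟨m, hm⟩ : ∃ m : ℝ, m = (μ s).toReal := ⟨_, rfl⟩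
  rw [← hm] at hc
  have hm0 : 0 < m := by
    rcases eq_or_lt_of_le (ENNReal.toReal_nonneg : 0 ≤ (μ s).toReal) with h0 | h0
    · rw [hm, ← h0, mul_zero, zero_mul] at hc
      exact absurd hc hC.not_gt
    · rwa [hm]
  have hlt : C / (r * m) < ∫ τ in s..s', V τ := by
    rw [div_lt_iff₀ (by positivity)]
    linarith
  obtain ⟨t, ht, hte⟩ := intermediate_value_Icc h.1.1.1
    (f := fun t => ∫ τ in s..t, V τ) (hV.integral_interval s).continuousOn
    (show C / (r * m) ∈ Icc _ _ from ⟨by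
      simp only [intervalIntegral.integral_same]; positivity, hlt.le⟩)
  have hte' : ∫ τ in s..t, V τ = C / (r * m) := hte
  have hle : s' ≤ t := h.2 ⟨⟨ht.1, ht.2.trans h.1.1.2⟩, Or.inl (by
    rw [hte', ENNReal.ofReal_div_of_pos (by positivity), ENNReal.ofReal_mul hr.le, hm,
      ENNReal.ofReal_toReal hμ])⟩
  rw [le_antisymm ht.2 hle] at hte'
  exact absurd hte' hlt.ne'

theorem IsGreedyStep.mul_eq (hr : 0 < r) {s s' : ℝ}
    (h : IsGreedyStep V μ r C t₁ s s') (hμ : μ s ≠ ∞) (hs' : s' ≠ t₁) (hC : 0 < C) :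
    ENNReal.ofReal r * (μ s * ENNReal.ofReal (∫ τ in s..s', V τ)) = ENNReal.ofReal C := by
  have h1 := h.1.2.resolve_right hs'
  have hr' : ENNReal.ofReal r ≠ 0 := by simpa using hr
  -- If `μ s` were 0 the prescribed length would be infinite.
  have hμ0 : μ s ≠ 0 := by
    intro h0
    rw [h0, mul_zero, ENNReal.div_zero (by simpa using hC)] at h1
    exact ENNReal.ofReal_ne_top h1
  rw [ENNReal.eq_div_iff (mul_ne_zero hr' hμ0) (ENNReal.mul_ne_top ENNReal.ofReal_ne_top hμ)] at h1
  rw [← h1, mul_assoc]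

/-- `μ` changes by a bounded factor over pieces of length at most `C / (r * μ)`. -/
def IsStable (V : ℝ → ℝ) (t₀ t₁ : ℝ) (μ : ℝ → ℝ≥0∞) (r C q Q : ℝ) : Prop :=
  ∀ s ∈ Icc t₀ t₁, ∀ t ∈ Icc t₀ t₁, μ s ≠ ∞ → r * (μ s).toReal * |∫ τ in s..t, V τ| ≤ C →
    μ t ≤ ENNReal.ofReal Q * μ s ∧ μ s ≤ ENNReal.ofReal q * μ t

theorem IsGreedyStep.le_of_isStable (hV : Continuous V) (hV0 : ∀ t, 0 ≤ V t) (hC : 0 < C)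
    (hr : 0 < r) (hst : IsStable V t₀ t₁ μ r C q Q) {s s' : ℝ} (hs : t₀ ≤ s)
    (h : IsGreedyStep V μ r C t₁ s s') (hμ : μ s ≠ ∞) {t : ℝ} (ht : t ∈ Icc s s') :
    μ t ≤ ENNReal.ofReal Q * μ s ∧ μ s ≤ ENNReal.ofReal q * μ t := by
  have hs1 := h.1.1.1.trans h.1.1.2
  refine hst s ⟨hs, hs1⟩ t ⟨hs.trans ht.1, ht.2.trans h.1.1.2⟩ hμ
    (le_trans ?_ (h.mul_le hV hC hr hμ))
  have h1 : ∫ τ in s..t, V τ ≤ ∫ τ in s..s', V τ :=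
    intervalIntegral.integral_mono_interval le_rfl ht.1 ht.2
      (Filter.Eventually.of_forall hV0) (hV.intervalIntegrable _ _)
  rw [abs_of_nonneg (intervalIntegral.integral_nonneg ht.1 fun τ _ => hV0 τ)]
  gcongr

/-- On the piece `μ s` is at most `q` times `μ t`, so the constant integrand in $C=r\mu(s)\int V$
may be replaced by $q\mu V$. -/
theorem IsGreedyStep.le_setLIntegral (hV : Continuous V) (hV0 : ∀ t, 0 ≤ V t) (hC : 0 < C)
    (hr : 0 < r) (hst : IsStable V t₀ t₁ μ r C q Q) {s s' : ℝ} (hs : t₀ ≤ s)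
    (h : IsGreedyStep V μ r C t₁ s s') (hμ : μ s ≠ ∞) (hs' : s' ≠ t₁) :
    ENNReal.ofReal C ≤
      ENNReal.ofReal r * (ENNReal.ofReal q * ∫⁻ t in Ioc s s', μ t * ENNReal.ofReal (V t)) := by
  rw [← h.mul_eq hr hμ hs' hC]
  gcongr ENNReal.ofReal r * ?_
  rw [← setLIntegral_Icc_ofReal hV hV0 h.1.1.1, ← lintegral_const_mul' _ _ hμ,
    ← lintegral_const_mul' _ _ ENNReal.ofReal_ne_top, setLIntegral_congr Ioc_ae_eq_Icc]
  refine setLIntegral_mono' measurableSet_Icc fun t ht => ?_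
  rw [← mul_assoc]
  gcongr
  exact (h.le_of_isStable hV hV0 hC hr hst hs hμ ht).2

theorem mul_le_setLIntegral_of_isGreedyStep (hV : Continuous V) (hV0 : ∀ t, 0 ≤ V t) (hC : 0 < C)
    (hr : 0 < r) (hst : IsStable V t₀ t₁ μ r C q Q) (hS0 : S 0 = t₀)
    (hS : ∀ i, IsGreedyStep V μ r C t₁ (S i) (S (i + 1))) (hμ : ∀ i, μ (S i) ≠ ∞) (k : ℕ)
    (hk : S k ≠ t₁) :
    k * ENNReal.ofReal C ≤
      ENNReal.ofReal r * (ENNReal.ofReal q * ∫⁻ t in Ioc t₀ (S k), μ t * ENNReal.ofReal (V t)) := by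
  have hmono : Monotone S := monotone_nat_of_le_succ fun i => (hS i).1.1.1
  induction k with
  | zero => simp
  | succ k ih =>
    have h0 : t₀ ≤ S k := hS0 ▸ hmono (Nat.zero_le k)
    have hk' : S k ≠ t₁ := fun h => hk (le_antisymm (hS k).1.1.2 (h ▸ (hS k).1.1.1))
    have h1 := (hS k).le_setLIntegral hV hV0 hC hr hst h0 (hμ k) hk
    rw [← Ioc_union_Ioc_eq_Ioc h0 (hS k).1.1.1, lintegral_union measurableSet_Ioc
      (Ioc_disjoint_Ioc_of_le le_rfl), mul_add, mul_add]
    push_cast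
    rw [add_mul, one_mul]
    exact add_le_add (ih hk') h1

/-- A path of finite condition length that is not constant at a point with `μ = ∞` does not start
at such a point. -/
theorem ne_top_of_setLIntegral_ne_top (hV : Continuous V) (hV0 : ∀ t, 0 ≤ V t) (hC : 0 < C)
    (hr : 0 < r) (h01 : t₀ < t₁) (hst : IsStable V t₀ t₁ μ r C q Q)
    (hne : ∃ t ∈ Icc t₀ t₁, μ t ≠ ∞ ∨ V t ≠ 0)
    (hfin : ∫⁻ t in Icc t₀ t₁, μ t * ENNReal.ofReal (V t) ≠ ∞) : μ t₀ ≠ ∞ := by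
  intro htop
  have hV' : ∀ a b, IntervalIntegrable V volume a b := hV.intervalIntegrable
  have h0 : t₀ ∈ Icc t₀ t₁ := left_mem_Icc.2 h01.le
  have hzero : ∀ s ∈ Icc t₀ t₁, ∀ t ∈ Icc t₀ t₁, μ s = ∞ → r * (μ t).toReal *
      |∫ τ in t..s, V τ| ≤ C → μ t = ∞ := by
    intro s hs t ht hs' h
    by_contra hc
    have h1 := (hst t ht s hs hc h).1
    rw [hs', top_le_iff] at h1
    exact ENNReal.mul_ne_top ENNReal.ofReal_ne_top hc h1
  have hcompact : IsCompact (Icc t₀ t₁ ∩ {t | ∫ τ in t₀..t, V τ = 0}) :=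
    isCompact_Icc.inter_right (isClosed_eq (hV.integral_interval t₀) continuous_const)
  -- `σ` is the last time before which the path does not move; by stability over length 0, `μ` is
  -- infinite up to `σ`.
  obtain ⟨σ, ⟨hσ, hσ0⟩, hσmax⟩ := hcompact.exists_isGreatest ⟨t₀, h0, by simp⟩
  have hσ0' : ∫ τ in t₀..σ, V τ = 0 := hσ0
  have hflat : ∀ t ∈ Icc t₀ σ, μ t = ∞ := by
    intro t ht
    have h1 : ∫ τ in t₀..t, V τ = 0 := le_antisymm
      (hσ0' ▸ intervalIntegral.integral_mono_interval le_rfl ht.1 ht.2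
        (Filter.Eventually.of_forall hV0) (hV' _ _))
      (intervalIntegral.integral_nonneg ht.1 fun τ _ => hV0 τ)
    refine hzero t₀ h0 t ⟨ht.1, ht.2.trans hσ.2⟩ htop ?_
    rw [intervalIntegral.integral_symm, h1, neg_zero, abs_zero, mul_zero]
    exact hC.le
  rcases eq_or_lt_of_le hσ.2 with hσ1 | hσ1
  · obtain ⟨t, ht, h | h⟩ := hne
    · exact h (hflat t (hσ1 ▸ ht))
    · have h1 := intervalIntegral.integral_pos h01 hV.continuousOn (fun τ _ => hV0 τ)
        ⟨t, ht, lt_of_le_of_ne (hV0 t) (Ne.symm h)⟩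
      rw [← hσ1, hσ0'] at h1
      exact lt_irrefl _ h1
  · have hcr : ENNReal.ofReal (C / r) ≠ 0 := by
      simp only [ne_eq, ENNReal.ofReal_eq_zero, not_le]
      positivity
    obtain ⟨δ, hδ, hsmall⟩ := exists_pos_setLIntegral_lt_of_measure_lt hfin hcr
    obtain ⟨b, hσb, hb⟩ : ∃ b, σ < b ∧ b ≤ t₁ ∧ ENNReal.ofReal (b - σ) < δ := by
      have hlim : Filter.Tendsto (fun b => ENNReal.ofReal (b - σ)) (nhdsWithin σ (Ioi σ))
          (nhds 0) := by
        have hc : Continuous fun b : ℝ => ENNReal.ofReal (b - σ) :=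
          ENNReal.continuous_ofReal.comp (continuous_id.sub continuous_const)
        have h1 := hc.tendsto σ
        simp only [sub_self, ENNReal.ofReal_zero] at h1
        exact h1.mono_left nhdsWithin_le_nhds
      have h2 := (hlim.eventually (gt_mem_nhds hδ)).and (Ioc_mem_nhdsGT hσ1)
      obtain ⟨b, hb1, hb2⟩ := h2.exists
      exact ⟨b, hb2.1, hb2.2, hb1⟩
    have hbI : Icc σ b ⊆ Icc t₀ t₁ := Icc_subset_Icc hσ.1 hb.1
    have h1 := hsmall (Icc σ b) (lt_of_le_of_lt (Measure.restrict_apply_le _ _)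
      (by rw [Real.volume_Icc]; exact hb.2))
    rw [Measure.restrict_restrict measurableSet_Icc, inter_eq_left.2 hbI] at h1
    have hpos : 0 < ∫ τ in σ..b, V τ := by
      refine lt_of_le_of_ne (intervalIntegral.integral_nonneg hσb.le fun τ _ => hV0 τ) fun h2 => ?_
      refine absurd (hσmax ⟨hbI (right_mem_Icc.2 hσb.le), ?_⟩) hσb.not_ge
      change ∫ τ in t₀..b, V τ = 0
      rw [← intervalIntegral.integral_add_adjacent_intervals (hV' t₀ σ) (hV' σ b), hσ0', ← h2,
        add_zero]
    set h := ∫ τ in σ..b, V τ with hh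
    -- Were `μ t` finite and below $C/(rh)$, stability would carry finiteness from `t` back to `σ`.
    have hlow : ∀ t ∈ Icc σ b, ENNReal.ofReal (C / r) ≤ ENNReal.ofReal h * μ t := by
      intro t ht
      rcases eq_or_ne (μ t) ∞ with hμt | hμt
      · rw [hμt, ENNReal.mul_top (by simpa using hpos)]
        exact le_top
      · have h2 : C < r * (μ t).toReal * |∫ τ in t..σ, V τ| := by
          by_contra hc
          push Not at hc
          exact hμt (hzero σ hσ t (hbI ht) (hflat σ (right_mem_Icc.2 hσ.1)) hc)
        rw [intervalIntegral.integral_symm, abs_neg,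
          abs_of_nonneg (intervalIntegral.integral_nonneg ht.1 fun τ _ => hV0 τ)] at h2
        have h3 : ∫ τ in σ..t, V τ ≤ h :=
          intervalIntegral.integral_mono_interval le_rfl ht.1 ht.2
            (Filter.Eventually.of_forall hV0) (hV' _ _)
        rw [← ENNReal.ofReal_toReal hμt, ← ENNReal.ofReal_mul hpos.le]
        refine ENNReal.ofReal_le_ofReal ?_
        rw [div_le_iff₀ hr]
        have h4 := mul_le_mul_of_nonneg_left h3
          (mul_nonneg hr.le (ENNReal.toReal_nonneg (a := μ t)))
        linarith
    -- Integrated against `V`, the lower bound gives $\int_\sigma^b\mu V\ge C/r$ however close `b`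
    -- is to `σ`, against absolute continuity of the integral.
    have h5 : ENNReal.ofReal (C / r) * ENNReal.ofReal h ≤
        ENNReal.ofReal h * ∫⁻ t in Icc σ b, μ t * ENNReal.ofReal (V t) := by
      rw [hh, ← setLIntegral_Icc_ofReal hV hV0 hσb.le,
        ← lintegral_const_mul' _ _ ENNReal.ofReal_ne_top, setLIntegral_Icc_ofReal hV hV0 hσb.le,
        ← lintegral_const_mul' _ _ ENNReal.ofReal_ne_top]
      refine setLIntegral_mono' measurableSet_Icc fun t ht => ?_
      rw [← mul_assoc]
      gcongr
      exact hlow t ht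
    rw [mul_comm, ENNReal.mul_le_mul_iff_right (by simpa using hpos) ENNReal.ofReal_ne_top] at h5
    exact absurd h1 h5.not_gt

theorem le_pow_mul_of_isGreedyStep (hV : Continuous V) (hV0 : ∀ t, 0 ≤ V t) (hC : 0 < C)
    (hr : 0 < r) (hQ : 0 < Q) (hst : IsStable V t₀ t₁ μ r C q Q) (hS0 : S 0 = t₀)
    (hS : ∀ i, IsGreedyStep V μ r C t₁ (S i) (S (i + 1))) (k : ℕ) :
    μ (S k) ≤ ENNReal.ofReal Q ^ k * μ t₀ := by
  have hmono : Monotone S := monotone_nat_of_le_succ fun i => (hS i).1.1.1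
  induction k with
  | zero => simp [hS0]
  | succ k ih =>
    rcases eq_or_ne (μ (S k)) ∞ with h | h
    · rw [h, top_le_iff] at ih
      have h1 : μ t₀ = ∞ := by
        by_contra hc
        exact ENNReal.mul_ne_top (ENNReal.pow_ne_top ENNReal.ofReal_ne_top) hc ih
      rw [h1, ENNReal.mul_top (pow_ne_zero _ (by simpa using hQ))]
      exact le_top
    · have h1 := ((hS k).le_of_isStable hV hV0 hC hr hst (hS0 ▸ hmono (Nat.zero_le k)) h
        (right_mem_Icc.2 (hS k).1.1.1)).1
      rw [pow_succ', mul_assoc]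
      exact h1.trans (by gcongr)

/-- The greedy subdivision reaches `t₁` within the expected number of steps. -/
theorem eq_of_isGreedyStep (hV : Continuous V) (hV0 : ∀ t, 0 ≤ V t) (hC : 0 < C)
    (hr : 0 < r) (hq : 0 < q) (hqQ : q < Q) (hst : IsStable V t₀ t₁ μ r C q Q) (hS0 : S 0 = t₀)
    (hS : ∀ i, IsGreedyStep V μ r C t₁ (S i) (S (i + 1))) (hμ : μ t₀ ≠ ∞)
    (hfin : ∫⁻ t in Icc t₀ t₁, μ t * ENNReal.ofReal (V t) ≠ ∞) {k : ℕ} (hk : 1 ≤ k)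
    (hle : Q / C * r * (∫⁻ t in Icc t₀ t₁, μ t * ENNReal.ofReal (V t)).toReal ≤ k) :
    S k = t₁ := by
  by_contra hc
  have hμ' : ∀ i, μ (S i) ≠ ∞ := fun i => ne_top_of_le_ne_top
    (ENNReal.mul_ne_top (ENNReal.pow_ne_top ENNReal.ofReal_ne_top) hμ)
    (le_pow_mul_of_isGreedyStep hV hV0 hC hr (hq.trans hqQ) hst hS0 hS i)
  have hk1 : S k ≤ t₁ := by
    obtain ⟨j, rfl⟩ := Nat.exists_eq_add_of_le' hk
    exact (hS j).1.1.2
  have h1 := mul_le_setLIntegral_of_isGreedyStep hV hV0 hC hr hst hS0 hS hμ' k hc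
  have h2 : ∫⁻ t in Ioc t₀ (S k), μ t * ENNReal.ofReal (V t) ≤
      ∫⁻ t in Icc t₀ t₁, μ t * ENNReal.ofReal (V t) :=
    lintegral_mono_set (Ioc_subset_Icc_self.trans (Icc_subset_Icc_right hk1))
  set X := ∫⁻ t in Icc t₀ t₁, μ t * ENNReal.ofReal (V t)
  have h3 : (k : ℝ≥0∞) * ENNReal.ofReal C ≤ ENNReal.ofReal r * (ENNReal.ofReal q * X) :=
    h1.trans (by gcongr)
  have h4 := ENNReal.toReal_mono (ENNReal.mul_ne_top ENNReal.ofReal_ne_top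
    (ENNReal.mul_ne_top ENNReal.ofReal_ne_top hfin)) h3
  simp only [ENNReal.toReal_mul, ENNReal.toReal_natCast, ENNReal.toReal_ofReal hC.le,
    ENNReal.toReal_ofReal hr.le, ENNReal.toReal_ofReal hq.le] at h4
  have hk' : (1 : ℝ) ≤ k := by exact_mod_cast hk
  -- Positivity makes `q < Q` yield a strict inequality, so that rounding up suffices without an
  -- extra step. This is where `1 ≤ k` enters.
  have hX : 0 < X.toReal := by
    by_contra hX
    have hX0 : X.toReal = 0 := le_antisymm (not_lt.1 hX) ENNReal.toReal_nonneg
    rw [hX0, mul_zero, mul_zero] at h4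
    nlinarith
  have h5 : Q / C * r * X.toReal * C ≤ k * C := by gcongr
  have h6 : Q / C * r * X.toReal * C = r * (Q * X.toReal) := by field_simp
  have h7 : r * (q * X.toReal) < r * (Q * X.toReal) := by gcongr
  linarith

end Greedy

/-! ### Transfer to paths in the solution variety -/

section Subdivision

open Set MeasureTheory

variable {n : ℕ} {d : Fin n → ℕ} {t₀ t₁ : ℝ} {f : ℝ → PolySystem n d}
  {ζ : ℝ → EuclideanSpace ℂ (Fin (n + 1))} {V : ℝ → ℝ}

theorem IsC1SolutionPath.isStable (hd : ∀ i, 1 ≤ d i) (h01 : t₀ < t₁)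
    (h : IsC1SolutionPath t₀ t₁ f ζ) (hV : Continuous V)
    (hVs : EqOn V (pathSpeed t₀ t₁ f ζ) (Icc t₀ t₁)) {η : ℝ} (hη0 : 0 < η) (hη : η < 1 / 2) :
    IsStable V t₀ t₁ (fun t => (f t).muNorm (ζ t)) ((maxDegree d : ℝ) ^ (3 / 2 : ℝ)) (η / 16)
      ((1 - η) / (1 - 2 * η)) (1 / (1 - η)) := by
  intro s hs t ht hμ hdist
  obtain ⟨r, hr⟩ : ∃ r : ℝ, r = (maxDegree d : ℝ) ^ (3 / 2 : ℝ) := ⟨_, rfl⟩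
  have hr0 : 0 ≤ r := by rw [hr]; positivity
  obtain ⟨M, hM⟩ : ∃ M : ℝ, M = ((f s).muNorm (ζ s)).toReal := ⟨_, rfl⟩
  have hM0 : 0 ≤ M := hM ▸ ENNReal.toReal_nonneg
  have hMs : (f s).muNorm (ζ s) = ENNReal.ofReal M := by rw [hM, ENNReal.ofReal_toReal hμ]
  have h1η : 0 < 1 - η := by linarith
  have h2η : 0 < 1 - 2 * η := by linarith
  simp only [← hM, ← hr] at hdist
  have h1 := h.muNorm_le hd h01 hV hVs hs ht hM0 hMs.le (by linarith) (η := η)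
    (by rw [← hr]; linarith)
  have hμt : (f t).muNorm (ζ t) ≠ ∞ := ne_top_of_le_ne_top ENNReal.ofReal_ne_top h1
  obtain ⟨N, hN⟩ : ∃ N : ℝ, N = ((f t).muNorm (ζ t)).toReal := ⟨_, rfl⟩
  have hN0 : 0 ≤ N := hN ▸ ENNReal.toReal_nonneg
  have hNt : (f t).muNorm (ζ t) = ENNReal.ofReal N := by rw [hN, ENNReal.ofReal_toReal hμt]
  have hNM : N ≤ M / (1 - η) := by
    rw [hNt] at h1
    exact (ENNReal.ofReal_le_ofReal_iff (by positivity)).1 h1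
  -- The reverse comparison applies the Lipschitz bound from `t` to `s`. There `μ` may have grown by
  -- $1/(1-\eta)$, so the parameter becomes $\eta/(1-\eta)$ and the factor $1/(1-\eta/(1-\eta))$.
  have hdist' : 16 * r * N * |∫ τ in t..s, V τ| ≤ η / (1 - η) := by
    rw [intervalIntegral.integral_symm, abs_neg]
    calc 16 * r * N * |∫ τ in s..t, V τ|
        ≤ 16 * r * (M / (1 - η)) * |∫ τ in s..t, V τ| := by gcongr
      _ = 16 * (r * M * |∫ τ in s..t, V τ|) / (1 - η) := by ring
      _ ≤ 16 * (η / 16) / (1 - η) := by gcongr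
      _ = η / (1 - η) := by ring
  have h2 := h.muNorm_le hd h01 hV hVs ht hs hN0 hNt.le (η := η / (1 - η))
    (by rw [div_lt_one h1η]; linarith) (by rw [← hr]; exact hdist')
  constructor
  · refine h1.trans (le_of_eq ?_)
    simp only [hMs]
    rw [← ENNReal.ofReal_mul (by positivity)]
    congr 1
    ring
  · refine h2.trans (le_of_eq ?_)
    simp only [hNt]
    rw [← ENNReal.ofReal_mul (by positivity)]
    congr 1
    have : 1 - η / (1 - η) = (1 - 2 * η) / (1 - η) := by field_simp; ring
    rw [this]
    field_simp

theorem pathLength_eq (hV : Continuous V) (hV0 : ∀ t, 0 ≤ V t)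
    (hVs : EqOn V (pathSpeed t₀ t₁ f ζ) (Icc t₀ t₁)) {a b : ℝ} (ha : t₀ ≤ a) (hab : a ≤ b)
    (hb : b ≤ t₁) : pathLength t₀ t₁ f ζ a b = ENNReal.ofReal (∫ t in a..b, V t) := by
  rw [← setLIntegral_Icc_ofReal hV hV0 hab]
  refine setLIntegral_congr_fun measurableSet_Icc fun t ht => ?_
  simp only [hVs ⟨ha.trans ht.1, ht.2.trans hb⟩]

theorem isLeast_step_iff (hV : Continuous V) (hV0 : ∀ t, 0 ≤ V t)
    (hVs : EqOn V (pathSpeed t₀ t₁ f ζ) (Icc t₀ t₁)) {C s s' : ℝ} (hs : t₀ ≤ s) :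
    IsLeast {t : ℝ | t ∈ Icc s t₁ ∧ (pathLength t₀ t₁ f ζ s t =
        ENNReal.ofReal C /
          (ENNReal.ofReal ((maxDegree d : ℝ) ^ (3 / 2 : ℝ)) * (f s).muNorm (ζ s)) ∨
      t = t₁)} s' ↔
    IsGreedyStep V (fun t => (f t).muNorm (ζ t)) ((maxDegree d : ℝ) ^ (3 / 2 : ℝ)) C t₁ s s' := by
  unfold IsGreedyStep
  refine iff_of_eq (congrArg (fun A => IsLeast A s') (Set.ext fun t => ?_))
  refine and_congr_right fun ht => ?_
  rw [pathLength_eq hV hV0 hVs hs ht.1 ht.2]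

theorem IsGreedySubdivision.isGreedyStep (hV : Continuous V) (hV0 : ∀ t, 0 ≤ V t)
    (hVs : EqOn V (pathSpeed t₀ t₁ f ζ) (Icc t₀ t₁)) {C : ℝ} {S : ℕ → ℝ}
    (hS : IsGreedySubdivision C t₀ t₁ f ζ S) (i : ℕ) :
    IsGreedyStep V (fun t => (f t).muNorm (ζ t)) ((maxDegree d : ℝ) ^ (3 / 2 : ℝ)) C t₁
      (S i) (S (i + 1)) := by
  have hmono : Monotone S := monotone_nat_of_le_succ fun i => (hS.step i).1.1.1
  exact (isLeast_step_iff hV hV0 hVs (hS.start ▸ hmono (Nat.zero_le i))).1 (hS.step i)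

theorem exists_isGreedySubdivision (h01 : t₀ ≤ t₁) (hV : Continuous V) (hV0 : ∀ t, 0 ≤ V t)
    (hVs : EqOn V (pathSpeed t₀ t₁ f ζ) (Icc t₀ t₁)) (C : ℝ) :
    ∃ S : ℕ → ℝ, IsGreedySubdivision C t₀ t₁ f ζ S := by
  choose next hnext using fun s : Icc t₀ t₁ => exists_isGreedyStep hV
    (fun t => (f t).muNorm (ζ t)) ((maxDegree d : ℝ) ^ (3 / 2 : ℝ)) C s.2.2
  let g : Icc t₀ t₁ → Icc t₀ t₁ := fun s =>
    ⟨next s, s.2.1.trans (hnext s).1.1.1, (hnext s).1.1.2⟩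
  refine ⟨fun i => (g^[i] ⟨t₀, left_mem_Icc.2 h01⟩ : Icc t₀ t₁), rfl, fun i => ?_⟩
  rw [isLeast_step_iff hV hV0 hVs (Subtype.property (g^[i] _)).1, Function.iterate_succ_apply']
  exact hnext _

end Subdivision

/-! ### Choice of the constant and conclusion -/

theorem proposition1 (ε : ℝ) (hε : 0 < ε) :
    ∃ C : ℝ, 0 < C ∧
      ∀ (n : ℕ) (d : Fin n → ℕ) (_ : ∀ i, 1 ≤ d i) (t₀ t₁ : ℝ) (_ : t₀ ≤ t₁)
        (f : ℝ → PolySystem n d) (ζ : ℝ → EuclideanSpace ℂ (Fin (n + 1)))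
        (_ : IsC1SolutionPath t₀ t₁ f ζ)
        -- the path is not a constant path at a pair with infinite condition number
        (_ : ∃ t ∈ Set.Icc t₀ t₁, (f t).muNorm (ζ t) ≠ ∞ ∨ pathSpeed t₀ t₁ f ζ t ≠ 0),
        (∃ S : ℕ → ℝ, IsGreedySubdivision C t₀ t₁ f ζ S) ∧
        ∀ S : ℕ → ℝ, IsGreedySubdivision C t₀ t₁ f ζ S →
          (conditionLength t₀ t₁ f ζ ≠ ∞ →
            ∃ k : ℕ, S k = t₁ ∧
              k ≤ max 1 ⌈(1 + ε) / C * (maxDegree d : ℝ) ^ (3 / 2 : ℝ) *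
                (conditionLength t₀ t₁ f ζ).toReal⌉₊) ∧
          ∀ k : ℕ, S k = t₁ →
            (f t₁).muNorm (ζ t₁) ≤ ENNReal.ofReal (1 + ε) ^ k * (f t₀).muNorm (ζ t₀) := by
  -- Chosen so that $\eta(1+2\varepsilon)=\varepsilon/2<\varepsilon$, which is equivalent to
  -- $(1-\eta)/(1-2\eta)<1+\varepsilon$ with room to spare; also $1/(1-\eta)\le 1+\varepsilon$.
  obtain ⟨η, hη⟩ : ∃ η : ℝ, η = ε / (2 + 4 * ε) := ⟨_, rfl⟩
  have hη0 : 0 < η := by rw [hη]; positivity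
  have hηε : η * (2 + 4 * ε) = ε := by rw [hη]; field_simp
  have hη4 : η < 1 / 4 := by rw [hη, div_lt_div_iff₀ (by positivity) (by norm_num)]; linarith
  refine ⟨η / 16, by positivity, fun n d hd t₀ t₁ h01 f ζ h hne => ?_⟩
  rcases eq_or_lt_of_le h01 with rfl | h01'
  · refine ⟨exists_isGreedySubdivision le_rfl continuous_const (fun _ => le_rfl)
      (fun t _ => (pathSpeed_eq_zero_of_subsingleton t).symm) _, fun S hS =>
      ⟨fun _ => ⟨0, hS.start, Nat.zero_le _⟩, fun k _ => ?_⟩⟩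
    refine le_mul_of_one_le_left zero_le (one_le_pow₀ ?_)
    rw [← ENNReal.ofReal_one]
    exact ENNReal.ofReal_le_ofReal (by linarith)
  obtain ⟨V, hV, hVs, hVr⟩ := (h.continuousOn_pathSpeed h01').exists_continuous_eqOn_Icc h01
  have hV0 : ∀ t, 0 ≤ V t := fun t => by
    obtain ⟨s, hs⟩ := hVr t
    rw [hs]
    exact pathSpeed_nonneg s
  have hr : 0 < (maxDegree d : ℝ) ^ (3 / 2 : ℝ) := by
    have := PolySystem.one_le_maxDegree hd (PolySystem.ne_zero_of_system_ne_zero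
      (h.system_ne_zero t₀ (Set.left_mem_Icc.2 h01)))
    positivity
  have h1η : 0 < 1 - η := by linarith
  have h2η : 0 < 1 - 2 * η := by linarith
  have hst : IsStable V t₀ t₁ (fun t => (f t).muNorm (ζ t)) ((maxDegree d : ℝ) ^ (3 / 2 : ℝ))
      (η / 16) ((1 - η) / (1 - 2 * η)) (1 + ε) := fun s hs t ht hμ hdist => by
    obtain ⟨h1, h2⟩ := h.isStable hd h01' hV hVs hη0 (by linarith) s hs t ht hμ hdist
    refine ⟨h1.trans ?_, h2⟩
    gcongr
    rw [div_le_iff₀ h1η]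
    nlinarith
  have hcond : conditionLength t₀ t₁ f ζ =
      ∫⁻ t in Set.Icc t₀ t₁, (f t).muNorm (ζ t) * ENNReal.ofReal (V t) := by
    refine MeasureTheory.setLIntegral_congr_fun measurableSet_Icc fun t ht => ?_
    simp only [hVs ht]
  refine ⟨exists_isGreedySubdivision h01 hV hV0 hVs _, fun S hS => ⟨fun hfin => ?_, fun k hk => ?_⟩⟩
  · rw [hcond] at hfin ⊢
    have hμ := ne_top_of_setLIntegral_ne_top hV hV0 (by positivity) hr h01' hst (by
      obtain ⟨t, ht, h'⟩ := hne
      exact ⟨t, ht, by rwa [hVs ht]⟩) hfin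
    refine ⟨_, eq_of_isGreedyStep hV hV0 (by positivity) hr (by positivity) ?_ hst hS.start
      (hS.isGreedyStep hV hV0 hVs) hμ hfin (le_max_left 1 _) ?_, le_rfl⟩
    · rw [div_lt_iff₀ h2η]
      nlinarith
    · push_cast
      exact (Nat.le_ceil _).trans (le_max_right _ _)
  · rw [← hk]
    exact le_pow_mul_of_isGreedyStep hV hV0 (by positivity) hr (by positivity) hst hS.start
      (hS.isGreedyStep hV hV0 hVs) k
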